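/- **Conventions.** Let $n\ge 1$ and let $\Omega\subseteq\mathbb{R}^n$ be a nonempty open set; functions and distributions are real-valued, $1<p<\infty$, $p'=p/(p-1)$, and $D'(\Omega)$ is the space of distributions on $\Omega$. *Sobolev–Slobodeckij spaces.* For $s=k+\theta\ge 0$ with $k\in\mathbb{N}_0$, $\theta\in[0,1)$, the space $W^{s,p}(\Omega)$ consists of all $u\in L^p(\Omega)$ with $\partial^\nu u\in L^p(\Omega)$ for $|\nu|\le k$ and finite norm $$\|u\|_{W^{s,p}(\Omega)}=\sum_{|\nu|\le k}\|\partial^\nu u\|_{L^p(\Omega)}+\sum_{|\nu|=k}\Big(\iint_{\Omega\times\Omega}\frac{|\partial^\nu u(x)-\partial^\nu u(y)|^p}{|x-y|^{n+\theta p}}\,dx\,dy\Big)^{1/p},$$ where the last sum is omitted if $\theta=0$. $W^{s,p}_0(\Omega)$ is the closure of $C_c^\infty(\Omega)$ in $W^{s,p}(\Omega)$, and for $s<0$, $W^{s,p}(\Omega):=(W^{-s,p'}_0(\Omega))^*$, with the dual norm. For all $s\in\mathbb{R}$, $W^{s,p}(\Omega)$ is regarded as a subspace of $D'(\Omega)$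 (for $s<0$ by restricting functionals to $C_c^\infty(\Omega)$). *Locally Sobolev spaces.* $W^{s,p}_{loc}(\Omega)=\{u\in D'(\Omega):\ \varphi u\in W^{s,p}(\Omega)\ \text{for all } \varphi\in C_c^\infty(\Omega)\}$, with the topology induced by the seminorms $u\mapsto\|\varphi u\|_{W^{s,p}(\Omega)}$, $\varphi\in C_c^\infty(\Omega)$. *Smooth multiplication triples.* $(s,p,\Omega)$ is a smooth multiplication triple if for every $\varphi\in C_c^\infty(\Omega)$ the map $u\mapsto\varphi u$ is well defined and bounded from $W^{s,p}(\Omega)$ to $W^{s,p}(\Omega)$. *Interior Lipschitz property.* $\Omega$ has the interior Lipschitz property if for every compact $K\subseteq\Omega$ there is a bounded open set $\Omega'\subseteq\Omega$ with Lipschitz continuous boundary such that $K\subseteq\Omega'$. **Theorem (Compact Embedding).** Let $\Omega\subseteq\mathbb{R}^n$ be a nonempty open set that has the interior Lipschitz property, let $s_1,s_2\in\mathbb{R}$ and $1<p_1,p_2<\infty$. Suppose that $(s_1,p_1,\Omega)$ and $(-s_1,p_1',\Omega)$ are smooth multiplication triples. If $s_2<0$, assume further that $(-s_2,p_2',\Omega)$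 is a smooth multiplication triple. Moreover, suppose that $W^{s_1,p_1}(U)$ is compactly embedded in $W^{s_2,p_2}(U)$ (that is, $W^{s_1,p_1}(U)\subseteq W^{s_2,p_2}(U)$ and the inclusion is a compact operator) for every nonempty bounded open set $U\subseteq\mathbb{R}^n$ with Lipschitz continuous boundary. Then every bounded sequence in $W^{s_1,p_1}_{loc}(\Omega)$ has a subsequence that lies in $W^{s_2,p_2}_{loc}(\Omega)$ and converges there. -/

import Mathlib

open MeasureTheory TopologicalSpace Filter Topology Set
open scoped ENNReal NNReal Distributions

namespace LocallySobolev

/-- The Euclidean space `ℝⁿ`. -/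
abbrev Space (n : ℕ) : Type := EuclideanSpace ℝ (Fin n)

instance factOneLeOfReal (p : ℝ) [hp : Fact (1 < p)] : Fact ((1 : ℝ≥0∞) ≤ ENNReal.ofReal p) :=
  ⟨ENNReal.one_le_ofReal.2 hp.out.le⟩

instance factConjExponent (p : ℝ) [hp : Fact (1 < p)] : Fact (1 < p.conjExponent) :=
  ⟨(Real.HolderConjugate.conjExponent hp.out).symm.lt⟩

/-! ### Operations on distributions -/

/-- Lebesgue measure on the open set `Ω`. -/
noncomputable abbrev vol {n : ℕ} (Ω : Opens (Space n)) : Measure (Space n) :=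
  volume.restrict (Ω : Set (Space n))

/-- The distribution `φ ↦ ∫_Ω f φ dx` of a locally integrable function `f` on `Ω`. -/
noncomputable def ofFun {n : ℕ} (Ω : Opens (Space n)) (f : Space n → ℝ) : 𝓓'(Ω, ℝ) :=
  (TestFunction.integralAgainstBilinCLM (ContinuousLinearMap.mul ℝ ℝ) (vol Ω) f :
    𝓓(Ω, ℝ) →L[ℝ] ℝ)

theorem ofFun_apply {n : ℕ} {Ω : Opens (Space n)} {f : Space n → ℝ}
    (hf : LocallyIntegrableOn f Ω (vol Ω)) (φ : 𝓓(Ω, ℝ)) :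
    ofFun Ω f φ = ∫ x in (Ω : Set (Space n)), φ x * f x := 
  TestFunction.integralAgainstBilinCLM_eq_integral (B := ContinuousLinearMap.mul ℝ ℝ) hf

theorem locallyIntegrableOn_lp {n : ℕ} {Ω : Opens (Space n)} {p : ℝ} [Fact (1 < p)]
    (f : Lp ℝ (ENNReal.ofReal p) (vol Ω)) : LocallyIntegrableOn f Ω (vol Ω) :=
  ((Lp.memLp f).locallyIntegrable Fact.out).locallyIntegrableOn _

theorem integrable_test_mul {n : ℕ} {Ω : Opens (Space n)} {f : Space n → ℝ}
    (hf : LocallyIntegrableOn f Ω (vol Ω)) (φ : 𝓓(Ω, ℝ)) :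
    Integrable (fun x => φ x * f x) (vol Ω) :=
  φ.integrable_bilin (ContinuousLinearMap.mul ℝ ℝ) hf

/-- The inclusion of `L^p(Ω)` in the space of distributions. -/
noncomputable def lpToDistr {n : ℕ} (Ω : Opens (Space n)) (p : ℝ) [Fact (1 < p)] :
    Lp ℝ (ENNReal.ofReal p) (vol Ω) →ₗ[ℝ] 𝓓'(Ω, ℝ) where
  toFun f := ofFun Ω f
  map_add' f g := by
    ext φ
    change ofFun Ω _ φ = ofFun Ω _ φ + ofFun Ω _ φ
    rw [ofFun_apply (locallyIntegrableOn_lp _), ofFun_apply (locallyIntegrableOn_lp _),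
      ofFun_apply (locallyIntegrableOn_lp _),
      ← integral_add (integrable_test_mul (locallyIntegrableOn_lp f) φ)
        (integrable_test_mul (locallyIntegrableOn_lp g) φ)]
    refine integral_congr_ae ?_
    filter_upwards [Lp.coeFn_add f g] with x hx
    rw [hx, Pi.add_apply, mul_add]
  map_smul' c f := by
    ext φ
    change ofFun Ω _ φ = c • ofFun Ω _ φ
    rw [ofFun_apply (locallyIntegrableOn_lp _), ofFun_apply (locallyIntegrableOn_lp _),
      smul_eq_mul, ← integral_const_mul]
    refine integral_congr_ae ?_
    filter_upwards [Lp.coeFn_smul c f] with x hx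
    rw [hx, Pi.smul_apply, smul_eq_mul]
    ring

/-- Multiplication of test functions by a fixed test function. -/
noncomputable def mulTest {n : ℕ} {Ω : Opens (Space n)} (φ : 𝓓(Ω, ℝ)) : 𝓓(Ω, ℝ) →L[ℝ] 𝓓(Ω, ℝ) :=
  TestFunction.limitCLM ℝ
    (fun ψ => ⟨fun x => ψ x * φ x, ψ.contDiff.mul φ.contDiff, ψ.hasCompactSupport.mul_right,
      (tsupport_mul_subset_left).trans ψ.tsupport_subset⟩)
    (fun _ hK => TestFunction.ofSupportedInCLM ℝ hK ∘L
      ContDiffMapSupportedIn.bilinLeftCLM (ContinuousLinearMap.mul ℝ ℝ) φ.contDiff)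
    (fun _ _ _ => by ext; simp)

/-- The product `φ u` of a test function and a distribution: `⟨φ u, ψ⟩ = ⟨u, φ ψ⟩`. -/
noncomputable def mulDistr {n : ℕ} {Ω : Opens (Space n)} (φ : 𝓓(Ω, ℝ)) :
    𝓓'(Ω, ℝ) →L[ℝ] 𝓓'(Ω, ℝ) :=
  (mulTest φ).precompCompactConvergenceCLM ℝ

theorem mulDistr_apply {n : ℕ} {Ω : Opens (Space n)} (φ : 𝓓(Ω, ℝ)) (u : 𝓓'(Ω, ℝ)) (ψ : 𝓓(Ω, ℝ)) :
    mulDistr φ u ψ = u (mulTest φ ψ) := rfl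

/-- The derivative `∂^ν u` of a distribution for the multi-index `ν`. -/
noncomputable def partialDistr {n : ℕ} {Ω : Opens (Space n)} (ν : Fin n → ℕ) :
    𝓓'(Ω, ℝ) →L[ℝ] 𝓓'(Ω, ℝ) :=
  ((List.finRange n).map fun i =>
    (Distribution.lineDerivCLM (EuclideanSpace.single i (1 : ℝ)) :
      𝓓'(Ω, ℝ) →L[ℝ] 𝓓'(Ω, ℝ)) ^ ν i).prod

/-- The derivative `∂^ν φ` of a test function for the multi-index `ν`. -/
noncomputable def partialTest {n : ℕ} {Ω : Opens (Space n)} (ν : Fin n → ℕ) :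
    𝓓(Ω, ℝ) →L[ℝ] 𝓓(Ω, ℝ) :=
  ((List.finRange n).map fun i =>
    (TestFunction.lineDerivCLM ℝ (EuclideanSpace.single i (1 : ℝ)) :
      𝓓(Ω, ℝ) →L[ℝ] 𝓓(Ω, ℝ)) ^ ν i).prod

theorem locallyIntegrableOn_test {n : ℕ} {Ω : Opens (Space n)} (φ : 𝓓(Ω, ℝ)) :
    LocallyIntegrableOn φ Ω (vol Ω) :=
  (φ.continuous.locallyIntegrable).locallyIntegrableOn _

theorem setIntegral_test {n : ℕ} {Ω : Opens (Space n)} (φ ψ : 𝓓(Ω, ℝ)) :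
    ∫ x in (Ω : Set (Space n)), φ x * ψ x = ∫ x, φ x * ψ x := by
  refine setIntegral_eq_integral_of_forall_compl_eq_zero fun x hx => ?_
  rw [image_eq_zero_of_notMem_tsupport (fun h => hx (φ.tsupport_subset h)), zero_mul]

theorem lineDeriv_ofFun {n : ℕ} {Ω : Opens (Space n)} (v : Space n) (φ : 𝓓(Ω, ℝ)) :
    (Distribution.lineDerivCLM v : 𝓓'(Ω, ℝ) →L[ℝ] 𝓓'(Ω, ℝ)) (ofFun Ω φ) =
      ofFun Ω (TestFunction.lineDerivCLM ℝ v φ : 𝓓(Ω, ℝ)) := by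
  ext ψ
  rw [Distribution.lineDerivCLM_apply, ofFun_apply (locallyIntegrableOn_test _),
    ofFun_apply (locallyIntegrableOn_test _), setIntegral_test, setIntegral_test]
  have hint (f g : 𝓓(Ω, ℝ)) : Integrable (fun x => f x * g x) :=
    f.integrable_bilin (ContinuousLinearMap.mul ℝ ℝ) (g.continuous.locallyIntegrable
      |>.locallyIntegrableOn _)
  have hd (f : 𝓓(Ω, ℝ)) (x : Space n) :
      (TestFunction.lineDerivCLM ℝ v f : 𝓓(Ω, ℝ)) x = fderiv ℝ f x v := by
    rw [TestFunction.lineDerivCLM_eq_fderivCLM, TestFunction.fderivCLM_apply_of_le _ (by simp)]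
  have hdiff (f : 𝓓(Ω, ℝ)) (x : Space n) : DifferentiableAt ℝ f x :=
    (f.contDiff.differentiable (by simp)).differentiableAt
  have key := integral_mul_fderiv_eq_neg_fderiv_mul_of_integrable (μ := volume) (f := ψ) (g := φ)
    (v := v)
    (by simpa only [hd] using hint (TestFunction.lineDerivCLM ℝ v ψ : 𝓓(Ω, ℝ)) φ)
    (by simpa only [hd] using hint ψ (TestFunction.lineDerivCLM ℝ v φ : 𝓓(Ω, ℝ)))
    (hint ψ φ) (fun x _ => hdiff ψ x) (fun x _ => hdiff φ x)
  simp only [hd]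
  rw [key]

theorem partialDistr_ofFun {n : ℕ} {Ω : Opens (Space n)} (ν : Fin n → ℕ) (φ : 𝓓(Ω, ℝ)) :
    partialDistr ν (ofFun Ω φ) = ofFun Ω (partialTest ν φ) := by
  have hpow (v : Space n) (m : ℕ) (φ : 𝓓(Ω, ℝ)) :
      ((Distribution.lineDerivCLM v : 𝓓'(Ω, ℝ) →L[ℝ] 𝓓'(Ω, ℝ)) ^ m) (ofFun Ω φ) =
        ofFun Ω (((TestFunction.lineDerivCLM ℝ v : 𝓓(Ω, ℝ) →L[ℝ] 𝓓(Ω, ℝ)) ^ m) φ) := by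
    induction m generalizing φ with
    | zero => rfl
    | succ m ih =>
      rw [pow_succ, pow_succ, mul_apply_eq_comp, mul_apply_eq_comp,
        lineDeriv_ofFun, ih]
  unfold partialDistr partialTest
  induction List.finRange n with
  | nil => rfl
  | cons i l ih =>
    rw [List.map_cons, List.map_cons, List.prod_cons, List.prod_cons,
      mul_apply_eq_comp, mul_apply_eq_comp, ih, hpow]

/-! ### Sobolev-Slobodeckij spaces of nonnegative order -/

/-- Multi-indices `ν ∈ ℕ₀ⁿ` with `|ν| ≤ k`. -/
abbrev MultiIndex (n k : ℕ) : Type := {ν : Fin n → Fin (k + 1) // ∑ i, (ν i : ℕ) ≤ k}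

/-- Multi-indices `ν ∈ ℕ₀ⁿ` with `|ν| = k`. -/
abbrev TopIndex (n k : ℕ) : Type := {ν : MultiIndex n k // ∑ i, (ν.1 i : ℕ) = k}

/-- The multi-index `0`. -/
def MultiIndex.zero (n k : ℕ) : MultiIndex n k := ⟨fun _ => 0, by simp⟩

/-- A multi-index as a family of natural numbers. -/
def MultiIndex.toNat {n k : ℕ} (ν : MultiIndex n k) : Fin n → ℕ := fun i => ν.1 i

/-- The space `⨁_{|ν| ≤ k} L^p(Ω) ⊕ ⨁_{|ν| = k} L^p(Ω × Ω)` with the sum of the norms. -/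
abbrev Jet {n : ℕ} (Ω : Opens (Space n)) (k : ℕ) (p : ℝ) [Fact (1 < p)] : Type :=
  WithLp 1 (PiLp 1 (fun _ : MultiIndex n k => Lp ℝ (ENNReal.ofReal p) (vol Ω)) ×
    PiLp 1 (fun _ : TopIndex n k => Lp ℝ (ENNReal.ofReal p) ((vol Ω).prod (vol Ω))))

/-- The difference quotient `(g(x) - g(y)) / |x - y|^{n/p + θ}`; its `L^p(Ω × Ω)` norm is the
Slobodeckij seminorm `|g|_{W^{θ,p}(Ω)}`. -/
noncomputable def diffQuot {n : ℕ} (p θ : ℝ) (g : Space n → ℝ) (z : Space n × Space n) : ℝ :=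
  (g z.1 - g z.2) / ‖z.1 - z.2‖ ^ (n / p + θ)

/-- For `s = k + θ ≥ 0` with `k ∈ ℕ₀` and `θ ∈ [0, 1)`, the space `W^{s,p}(Ω)`. A function
`u ∈ W^{s,p}(Ω)` is recorded together with its distributional derivatives `∂^ν u ∈ L^p(Ω)`,
`|ν| ≤ k`, and, if `θ > 0`, the difference quotients of `∂^ν u`, `|ν| = k`. Thus the norm is
`∑_{|ν| ≤ k} ‖∂^ν u‖_{L^p(Ω)} + ∑_{|ν| = k} |∂^ν u|_{W^{θ,p}(Ω)}`, without the second
sum if `θ = 0`. Only used for `s ≥ 0`. -/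
noncomputable def SobolevNonneg {n : ℕ} (Ω : Opens (Space n)) (s p : ℝ) [Fact (1 < p)] :
    Submodule ℝ (Jet Ω ⌊s⌋₊ p) where
  carrier := {w |
    (∀ ν : MultiIndex n ⌊s⌋₊,
      lpToDistr Ω p (w.fst ν) = partialDistr ν.toNat (lpToDistr Ω p (w.fst (.zero n _)))) ∧
    ∀ ν : TopIndex n ⌊s⌋₊,
      (Int.fract s = 0 → w.snd ν = 0) ∧
      (Int.fract s ≠ 0 → w.snd ν =ᵐ[(vol Ω).prod (vol Ω)] diffQuot p (Int.fract s) (w.fst ν.1))}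
  zero_mem' := by
    refine ⟨fun ν => ?_, fun ν => ⟨fun _ => rfl, fun _ => ?_⟩⟩
    · change lpToDistr Ω p 0 = partialDistr ν.toNat (lpToDistr Ω p 0)
      simp
    · change ((0 : Lp ℝ (ENNReal.ofReal p) ((vol Ω).prod (vol Ω))) : _ → ℝ) =ᵐ[_]
        diffQuot p (Int.fract s) (0 : Lp ℝ (ENNReal.ofReal p) (vol Ω))
      have h0 : ((0 : Lp ℝ (ENNReal.ofReal p) (vol Ω)) : _ → ℝ) =ᵐ[vol Ω] 0 := Lp.coeFn_zero _ _ _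
      filter_upwards [Lp.coeFn_zero ℝ (ENNReal.ofReal p) ((vol Ω).prod (vol Ω)),
        Measure.quasiMeasurePreserving_fst.ae h0, Measure.quasiMeasurePreserving_snd.ae h0]
        with z h1 h2 h3
      refine h1.trans ?_
      change (0 : ℝ) = (_ - _) / _
      rw [h2, h3]
      simp
  add_mem' := by
    rintro v w ⟨hv, hv'⟩ ⟨hw, hw'⟩
    refine ⟨fun ν => ?_, fun ν => ⟨fun h => ?_, fun h => ?_⟩⟩
    · change lpToDistr Ω p (v.fst ν + w.fst ν) =
        partialDistr ν.toNat (lpToDistr Ω p (v.fst (.zero n _) + w.fst (.zero n _)))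
      rw [map_add, map_add, map_add, hv, hw]
    · change v.snd ν + w.snd ν = 0
      rw [(hv' ν).1 h, (hw' ν).1 h, add_zero]
    · change ((v.snd ν + w.snd ν : Lp ℝ (ENNReal.ofReal p) ((vol Ω).prod (vol Ω))) : _ → ℝ) =ᵐ[_]
        diffQuot p (Int.fract s) (v.fst ν.1 + w.fst ν.1 : Lp ℝ (ENNReal.ofReal p) (vol Ω))
      have h0 := Lp.coeFn_add (v.fst ν.1) (w.fst ν.1)
      filter_upwards [Lp.coeFn_add (v.snd ν) (w.snd ν), (hv' ν).2 h, (hw' ν).2 h,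
        Measure.quasiMeasurePreserving_fst.ae h0, Measure.quasiMeasurePreserving_snd.ae h0]
        with z h1 h2 h3 h4 h5
      rw [h1, Pi.add_apply, h2, h3]
      simp only [diffQuot, h4, h5, Pi.add_apply]
      ring
  smul_mem' := by
    rintro c w ⟨hw, hw'⟩
    refine ⟨fun ν => ?_, fun ν => ⟨fun h => ?_, fun h => ?_⟩⟩
    · change lpToDistr Ω p (c • w.fst ν) =
        partialDistr ν.toNat (lpToDistr Ω p (c • w.fst (.zero n _)))
      rw [map_smul, map_smul, map_smul, hw]
    · change c • w.snd ν = 0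
      rw [(hw' ν).1 h, smul_zero]
    · change ((c • w.snd ν : Lp ℝ (ENNReal.ofReal p) ((vol Ω).prod (vol Ω))) : _ → ℝ) =ᵐ[_]
        diffQuot p (Int.fract s) (c • w.fst ν.1 : Lp ℝ (ENNReal.ofReal p) (vol Ω))
      have h0 := Lp.coeFn_smul c (w.fst ν.1)
      filter_upwards [Lp.coeFn_smul c (w.snd ν), (hw' ν).2 h,
        Measure.quasiMeasurePreserving_fst.ae h0, Measure.quasiMeasurePreserving_snd.ae h0]
        with z h1 h2 h4 h5
      rw [h1, Pi.smul_apply, h2]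
      simp only [diffQuot, h4, h5, Pi.smul_apply, smul_eq_mul]
      ring

/-- The inclusion of `W^{s,p}(Ω)`, `s ≥ 0`, in the space of distributions. -/
noncomputable def SobolevNonneg.toDistr {n : ℕ} (Ω : Opens (Space n)) (s p : ℝ) [Fact (1 < p)] :
    SobolevNonneg Ω s p →ₗ[ℝ] 𝓓'(Ω, ℝ) where
  toFun w := lpToDistr Ω p (w.1.fst (.zero n _))
  map_add' _ _ := map_add (lpToDistr Ω p) _ _
  map_smul' c _ := map_smul (lpToDistr Ω p) c _

theorem kernel_integrable {n : ℕ} {p θ : ℝ} (hp : 1 < p) (h0 : 0 < θ) (h1 : θ < 1) :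
    Integrable (fun z : Space n => (min ‖z‖ 1 / ‖z‖ ^ (n / p + θ)) ^ p) := by
  rcases Nat.eq_zero_or_pos n with rfl | hn
  · exact .of_finite
  have : Nonempty (Fin n) := ⟨⟨0, hn⟩⟩
  have : Nontrivial (EuclideanSpace ℝ (Fin n)) := inferInstance
  rw [integrable_fun_norm_addHaar volume (f := fun r : ℝ => (min r 1 / r ^ (n / p + θ)) ^ p)]
  have hd : Module.finrank ℝ (EuclideanSpace ℝ (Fin n)) = n := by simp
  rw [hd]
  have hu : Ioi (0 : ℝ) = Ioo 0 1 ∪ Ici 1 := (Ioo_union_Ici_eq_Ioi one_pos).symm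
  have hcast : ((n - 1 : ℕ) : ℝ) = (n : ℝ) - 1 := by rw [Nat.cast_sub hn]; simp
  have hp0 : p ≠ 0 := by linarith
  rw [hu]
  refine IntegrableOn.union ?_ ?_
  · have : IntegrableOn (fun r : ℝ => r ^ (p * (1 - θ) - 1)) (Ioo 0 1) := by
      rw [intervalIntegral.integrableOn_Ioo_rpow_iff one_pos]
      have := mul_pos (by linarith : 0 < p) (by linarith : 0 < 1 - θ)
      linarith
    refine this.congr_fun (fun r hr => ?_) measurableSet_Ioo
    have hr0 : 0 < r := hr.1
    simp only [smul_eq_mul]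
    rw [min_eq_left hr.2.le, Real.div_rpow hr0.le (by positivity), ← Real.rpow_mul hr0.le,
      ← Real.rpow_natCast, hcast, ← Real.rpow_sub hr0, ← Real.rpow_add hr0]
    congr 1
    field_simp
    ring
  · rw [integrableOn_Ici_iff_integrableOn_Ioi]
    have : IntegrableOn (fun r : ℝ => r ^ (-(p * θ) - 1)) (Ioi 1) := by
      apply integrableOn_Ioi_rpow_of_lt _ one_pos
      have := mul_pos (by linarith : 0 < p) h0
      linarith
    refine this.congr_fun (fun r hr => ?_) measurableSet_Ioi
    have hr1 : (1 : ℝ) < r := hr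
    have hr0 : 0 < r := by linarith
    simp only [smul_eq_mul]
    rw [min_eq_right hr1.le, Real.div_rpow zero_le_one (by positivity), ← Real.rpow_mul hr0.le,
      ← Real.rpow_natCast, hcast, Real.one_rpow, one_div, ← Real.rpow_neg hr0.le,
      ← Real.rpow_add hr0]
    congr 1
    field_simp
    ring

theorem memLp_diffQuot {n : ℕ} {Ω : Opens (Space n)} {p θ : ℝ} (hp : 1 < p) (h0 : 0 < θ)
    (h1 : θ < 1) (φ : 𝓓(Ω, ℝ)) :
    MemLp (diffQuot p θ φ) (ENNReal.ofReal p) ((vol Ω).prod (vol Ω)) := by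
  rw [Measure.prod_restrict]
  refine MemLp.restrict _ ?_
  obtain ⟨C₁, hC₁⟩ := φ.contDiff.lipschitzWith_of_hasCompactSupport φ.hasCompactSupport (by simp)
  obtain ⟨C₂, hC₂⟩ := φ.hasCompactSupport.exists_bound_of_continuous φ.continuous
  have hC₂0 : 0 ≤ C₂ := (norm_nonneg _).trans (hC₂ 0)
  set C : ℝ := C₁ + 2 * C₂ with hC
  have hC0 : 0 ≤ C := by positivity
  have hmin (x y : Space n) : |φ x - φ y| ≤ C * min ‖x - y‖ 1 := by
    rw [← Real.norm_eq_abs]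
    rcases le_total ‖x - y‖ 1 with h | h
    · rw [min_eq_left h]
      have := hC₁.norm_sub_le x y
      nlinarith [norm_nonneg (x - y)]
    · rw [min_eq_right h]
      have := (norm_sub_le (φ x) (φ y)).trans (add_le_add (hC₂ x) (hC₂ y))
      have : (0 : ℝ) ≤ C₁ := C₁.2
      linarith
  have hmeas : Measurable (diffQuot p θ φ) := by
    have := φ.continuous.measurable
    unfold diffQuot
    fun_prop
  have hpr : (ENNReal.ofReal p).toReal = p := ENNReal.toReal_ofReal (by linarith)
  rw [← integrable_norm_rpow_iff hmeas.aestronglyMeasurable (by simp; linarith) (by simp), hpr]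
  set κ : Space n → ℝ := fun z => (min ‖z‖ 1 / ‖z‖ ^ (n / p + θ)) ^ p with hκ
  have hκi : Integrable κ := kernel_integrable hp h0 h1
  have hκ0 (z : Space n) : 0 ≤ κ z := by positivity
  set χ : Space n → ℝ := (tsupport φ).indicator 1 with hχ
  have hχi : Integrable χ := by
    rw [hχ, integrable_indicator_iff (isClosed_tsupport _).measurableSet]
    exact integrableOn_const (C := (1 : ℝ)) φ.hasCompactSupport.measure_lt_top.ne
  have hχ0 (z : Space n) : 0 ≤ χ z := indicator_nonneg (fun _ _ => zero_le_one) _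
  have hA : Integrable (fun z : Space n × Space n => χ z.2 * κ (z.1 - z.2)) :=
    hχi.convolution_integrand (ContinuousLinearMap.mul ℝ ℝ) hκi
  have hB : Integrable (fun z : Space n × Space n => χ z.1 * κ (z.2 - z.1)) := hA.swap
  refine ((hA.add hB).const_mul (C ^ p)).mono'
    (hmeas.norm.pow_const p).aestronglyMeasurable (ae_of_all _ fun z => ?_)
  have hsymm : κ (z.2 - z.1) = κ (z.1 - z.2) := by simp only [hκ, norm_sub_rev]
  rw [Real.norm_of_nonneg (by positivity), Pi.add_apply, hsymm, ← add_mul]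
  by_cases hz : z.1 ∈ tsupport φ ∨ z.2 ∈ tsupport φ
  · have h1χ : 1 ≤ χ z.2 + χ z.1 := by
      rcases hz with h | h
      · have : χ z.1 = 1 := by simp [hχ, h]
        linarith [hχ0 z.2]
      · have : χ z.2 = 1 := by simp [hχ, h]
        linarith [hχ0 z.1]
    calc ‖diffQuot p θ φ z‖ ^ p ≤ (C * (min ‖z.1 - z.2‖ 1 / ‖z.1 - z.2‖ ^ (n / p + θ))) ^ p := by
          refine Real.rpow_le_rpow (norm_nonneg _) ?_ (by linarith)
          rw [diffQuot, norm_div, Real.norm_of_nonneg (by positivity :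
            0 ≤ ‖z.1 - z.2‖ ^ (n / p + θ)), ← mul_div_assoc]
          exact div_le_div_of_nonneg_right (hmin _ _) (by positivity)
      _ = C ^ p * κ (z.1 - z.2) := by rw [Real.mul_rpow hC0 (by positivity)]
      _ ≤ C ^ p * ((χ z.2 + χ z.1) * κ (z.1 - z.2)) := by
          refine mul_le_mul_of_nonneg_left ?_ (by positivity)
          exact le_mul_of_one_le_left (hκ0 _) h1χ
  · push Not at hz
    have : diffQuot p θ φ z = 0 := by
      rw [diffQuot, image_eq_zero_of_notMem_tsupport hz.1, image_eq_zero_of_notMem_tsupport hz.2]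
      simp
    rw [this, norm_zero, Real.zero_rpow (by linarith)]
    have := hχ0 z.1
    have := hχ0 z.2
    have := hκ0 (z.1 - z.2)
    positivity

theorem memLp_test {n : ℕ} {Ω : Opens (Space n)} (q : ℝ≥0∞) (φ : 𝓓(Ω, ℝ)) :
    MemLp φ q (vol Ω) :=
  φ.continuous.memLp_of_hasCompactSupport φ.hasCompactSupport

theorem lpToDistr_toLp {n : ℕ} {Ω : Opens (Space n)} (p : ℝ) [Fact (1 < p)] (φ : 𝓓(Ω, ℝ)) :
    lpToDistr Ω p ((memLp_test _ φ).toLp φ) = ofFun Ω φ := by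
  ext ψ
  change ofFun Ω _ ψ = _
  rw [ofFun_apply (locallyIntegrableOn_lp _), ofFun_apply (locallyIntegrableOn_test _)]
  refine integral_congr_ae ?_
  filter_upwards [(memLp_test (ENNReal.ofReal p) φ).coeFn_toLp] with x hx
  rw [hx]

open scoped Classical in
/-- A test function with its derivatives and the difference quotients of its derivatives. -/
noncomputable def testJet {n : ℕ} (Ω : Opens (Space n)) (s p : ℝ) [hp : Fact (1 < p)]
    (φ : 𝓓(Ω, ℝ)) : Jet Ω ⌊s⌋₊ p :=
  WithLp.toLp 1
    (WithLp.toLp 1 fun ν => (memLp_test _ (partialTest ν.toNat φ)).toLp _,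
      WithLp.toLp 1 fun ν => if h : Int.fract s = 0 then 0 else
        (memLp_diffQuot hp.out (lt_of_le_of_ne (Int.fract_nonneg s) (Ne.symm h))
          (Int.fract_lt_one s) (partialTest ν.1.toNat φ)).toLp _)

theorem partialTest_zero {n k : ℕ} {Ω : Opens (Space n)} (φ : 𝓓(Ω, ℝ)) :
    partialTest (MultiIndex.zero n k).toNat φ = φ := by
  have (l : List (Fin n)) : (l.map fun i =>
      (TestFunction.lineDerivCLM ℝ (EuclideanSpace.single i (1 : ℝ)) :
        𝓓(Ω, ℝ) →L[ℝ] 𝓓(Ω, ℝ)) ^ (MultiIndex.zero n k).toNat i).prod = 1 := by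
    refine List.prod_eq_one fun x hx => ?_
    obtain ⟨i, -, rfl⟩ := List.mem_map.1 hx
    exact pow_zero _
  rw [partialTest, this]
  rfl

theorem testJet_mem {n : ℕ} (Ω : Opens (Space n)) (s p : ℝ) [hp : Fact (1 < p)]
    (φ : 𝓓(Ω, ℝ)) : testJet Ω s p φ ∈ SobolevNonneg Ω s p := by
  have hz := partialTest_zero (k := ⌊s⌋₊) φ
  refine ⟨fun ν => ?_, fun ν => ⟨fun h => dif_pos h, fun h => ?_⟩⟩
  · change lpToDistr Ω p ((memLp_test _ (partialTest ν.toNat φ)).toLp _) = partialDistr ν.toNat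
      (lpToDistr Ω p ((memLp_test _ (partialTest (MultiIndex.zero n ⌊s⌋₊).toNat φ)).toLp _))
    rw [lpToDistr_toLp, lpToDistr_toLp, hz, partialDistr_ofFun]
  · have hval : (testJet Ω s p φ).snd ν = _ := dif_neg h
    rw [hval]
    have h0 := (memLp_test (ENNReal.ofReal p) (partialTest ν.1.toNat φ)).coeFn_toLp
    refine (MemLp.coeFn_toLp _).trans ?_
    filter_upwards [Measure.quasiMeasurePreserving_fst.ae h0,
      Measure.quasiMeasurePreserving_snd.ae h0] with z h1 h2
    change _ = diffQuot p _ ((memLp_test _ (partialTest ν.1.toNat φ)).toLp _) z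
    rw [diffQuot, diffQuot, h1, h2]

theorem SobolevNonneg.toDistr_injective {n : ℕ} (Ω : Opens (Space n)) (s p : ℝ) [Fact (1 < p)] :
    Function.Injective (SobolevNonneg.toDistr Ω s p) := by
  have hinj : Function.Injective (lpToDistr Ω p) := by
    rw [← LinearMap.ker_eq_bot, LinearMap.ker_eq_bot']
    intro f hf
    have h := Ω.isOpen.ae_eq_zero_of_integral_contDiff_smul_eq_zero (locallyIntegrableOn_lp f)
      (fun g hg hgc hgs => by
        have := ofFun_apply (locallyIntegrableOn_lp f) ⟨g, hg, hgc, hgs⟩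
        have h0 : ofFun Ω f ⟨g, hg, hgc, hgs⟩ = 0 := congrArg (fun T : 𝓓'(Ω, ℝ) => T _) hf
        rw [h0] at this
        exact this.symm)
    rw [Lp.eq_zero_iff_ae_eq_zero]
    filter_upwards [h, ae_restrict_mem Ω.isOpen.measurableSet] with x hx hxΩ using hx hxΩ
  rw [← LinearMap.ker_eq_bot, LinearMap.ker_eq_bot']
  rintro ⟨w, hw, hw'⟩ h
  have h0 : lpToDistr Ω p (w.fst (.zero n _)) = 0 := h
  have h1 (ν) : w.fst ν = 0 := hinj (by rw [hw, h0, map_zero, map_zero])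
  have h2 (ν) : w.snd ν = 0 := by
    by_cases hs : Int.fract s = 0
    · exact (hw' ν).1 hs
    · rw [Lp.eq_zero_iff_ae_eq_zero]
      have hz : (w.fst ν.1 : Space n → ℝ) =ᵐ[vol Ω] 0 := by
        rw [h1]
        exact Lp.coeFn_zero _ _ _
      filter_upwards [(hw' ν).2 hs, Measure.quasiMeasurePreserving_fst.ae hz,
        Measure.quasiMeasurePreserving_snd.ae hz] with z h3 h4 h5
      rw [h3, diffQuot, h4, h5]
      simp
  apply Subtype.ext
  have e1 : w.fst = 0 := PiLp.ext h1
  have e2 : w.snd = 0 := PiLp.ext h2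
  exact WithLp.ofLp_injective _ (Prod.ext e1 e2)

theorem toDistr_testJet {n : ℕ} (Ω : Opens (Space n)) (s p : ℝ) [Fact (1 < p)]
    (φ : 𝓓(Ω, ℝ)) :
    SobolevNonneg.toDistr Ω s p ⟨testJet Ω s p φ, testJet_mem Ω s p φ⟩ = ofFun Ω φ := by
  rw [← lpToDistr_toLp p φ]
  change lpToDistr Ω p ((memLp_test _ (partialTest (MultiIndex.zero n ⌊s⌋₊).toNat φ)).toLp _) = _
  congr 2
  rw [partialTest_zero]

/-- The inclusion of `C_c^∞(Ω)` in `W^{s,p}(Ω)`, `s ≥ 0`. -/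
noncomputable def testIncl {n : ℕ} (Ω : Opens (Space n)) (s p : ℝ) [Fact (1 < p)] :
    𝓓(Ω, ℝ) →ₗ[ℝ] SobolevNonneg Ω s p where
  toFun φ := ⟨testJet Ω s p φ, testJet_mem Ω s p φ⟩
  map_add' φ ψ := by
    apply SobolevNonneg.toDistr_injective
    rw [map_add, toDistr_testJet, toDistr_testJet, toDistr_testJet]
    ext χ
    change ofFun Ω _ χ = ofFun Ω _ χ + ofFun Ω _ χ
    have h (f : 𝓓(Ω, ℝ)) := locallyIntegrableOn_test f
    rw [ofFun_apply (h _), ofFun_apply (h _), ofFun_apply (h _),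
      ← integral_add (integrable_test_mul (h φ) χ) (integrable_test_mul (h ψ) χ)]
    exact integral_congr_ae (ae_of_all _ fun x => mul_add (χ x) (φ x) (ψ x))
  map_smul' c φ := by
    apply SobolevNonneg.toDistr_injective
    rw [map_smul, toDistr_testJet, toDistr_testJet]
    ext χ
    change ofFun Ω _ χ = c • ofFun Ω _ χ
    have h (f : 𝓓(Ω, ℝ)) := locallyIntegrableOn_test f
    rw [ofFun_apply (h _), ofFun_apply (h _), smul_eq_mul, ← integral_const_mul]
    exact integral_congr_ae (ae_of_all _ fun x => mul_left_comm (χ x) c (φ x))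

/-- The space `W^{s,p}_0(Ω)`, `s ≥ 0`: the closure of `C_c^∞(Ω)` in `W^{s,p}(Ω)`. -/
noncomputable def SobolevZero {n : ℕ} (Ω : Opens (Space n)) (s p : ℝ) [Fact (1 < p)] :
    Submodule ℝ (SobolevNonneg Ω s p) :=
  (LinearMap.range (testIncl Ω s p)).topologicalClosure

/-- The inclusion of `C_c^∞(Ω)` in `W^{s,p}_0(Ω)`, `s ≥ 0`. -/
noncomputable def testInclZero {n : ℕ} (Ω : Opens (Space n)) (s p : ℝ) [Fact (1 < p)] :
    𝓓(Ω, ℝ) →ₗ[ℝ] SobolevZero Ω s p :=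
  (testIncl Ω s p).codRestrict _ fun φ =>
    Submodule.le_topologicalClosure _ (LinearMap.mem_range_self _ φ)

/-! ### Sobolev-Slobodeckij spaces of real order, as spaces of distributions -/

/-- For `s < 0`, the space `W^{s,p}(Ω)` is the dual of `W^{-s,p'}_0(Ω)`. -/
abbrev SobolevDual {n : ℕ} (Ω : Opens (Space n)) (s p : ℝ) [Fact (1 < p)] : Type :=
  StrongDual ℝ (SobolevZero Ω (-s) p.conjExponent)

/-- Linear relations between a normed space `X` and the space of distributions on `Ω`. -/
abbrev DistrRel {n : ℕ} (X : Type) [NormedAddCommGroup X] [NormedSpace ℝ X]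
    (Ω : Opens (Space n)) : Type :=
  Submodule ℝ (X × 𝓓'(Ω, ℝ))

/-- For `s ≥ 0`, the pairs `(w, u)` of an element of `W^{s,p}(Ω)` and the distribution that it
defines. -/
noncomputable def nonnegGraph {n : ℕ} (Ω : Opens (Space n)) (s p : ℝ) [Fact (1 < p)] :
    DistrRel (SobolevNonneg Ω s p) Ω :=
  (SobolevNonneg.toDistr Ω s p).graph

/-- For `s < 0`, the pairs `(F, u)` of a functional `F ∈ W^{s,p}(Ω) = W^{-s,p'}_0(Ω)^*` and the
distribution `u = F|_{C_c^∞(Ω)}` that it defines. -/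
noncomputable def dualGraph {n : ℕ} (Ω : Opens (Space n)) (s p : ℝ) [Fact (1 < p)] :
    DistrRel (SobolevDual Ω s p) Ω where
  carrier := {w | ∀ φ : 𝓓(Ω, ℝ), w.1 (testInclZero Ω (-s) p.conjExponent φ) = w.2 φ}
  zero_mem' _ := rfl
  add_mem' hv hw φ := congrArg₂ (· + ·) (hv φ) (hw φ)
  smul_mem' c _ hw φ := congrArg (c • ·) (hw φ)

/-- The space `W^{s,p}(Ω)`, `s ∈ ℝ`, as a space of distributions. -/
noncomputable def sobolevSubmodule {n : ℕ} (Ω : Opens (Space n)) (s p : ℝ) [Fact (1 < p)] :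
    Submodule ℝ 𝓓'(Ω, ℝ) :=
  open scoped Classical in
  if 0 ≤ s then (nonnegGraph Ω s p).map (LinearMap.snd ℝ _ _)
  else (dualGraph Ω s p).map (LinearMap.snd ℝ _ _)

/-- The norm transported along a linear relation (below, to each `u` corresponds at most
one `x`). -/
noncomputable def graphNorm {n : ℕ} {X : Type} [NormedAddCommGroup X] [NormedSpace ℝ X]
    {Ω : Opens (Space n)} (R : DistrRel X Ω) (u : 𝓓'(Ω, ℝ)) : ℝ :=
  ⨅ x : {x : X // (x, u) ∈ R}, ‖(x : X)‖

theorem graphNorm_eq {n : ℕ} {X : Type} [NormedAddCommGroup X] [NormedSpace ℝ X]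
    {Ω : Opens (Space n)} {R : DistrRel X Ω} (hR : ∀ x, (x, 0) ∈ R → x = 0)
    {x : X} {u : 𝓓'(Ω, ℝ)} (h : (x, u) ∈ R) : graphNorm R u = ‖x‖ := by
  have huniq (y : {y : X // (y, u) ∈ R}) : y = ⟨x, h⟩ := by
    apply Subtype.ext
    rw [← sub_eq_zero]
    refine hR _ ?_
    have := R.sub_mem y.2 h
    rwa [Prod.mk_sub_mk, sub_self] at this
  let : Unique {y : X // (y, u) ∈ R} := ⟨⟨⟨x, h⟩⟩, huniq⟩
  rw [graphNorm, ciInf_unique]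
  rfl

theorem nonnegGraph_inj {n : ℕ} (Ω : Opens (Space n)) (s p : ℝ) [Fact (1 < p)]
    (w : SobolevNonneg Ω s p) (h : (w, 0) ∈ nonnegGraph Ω s p) : w = 0 := by
  apply SobolevNonneg.toDistr_injective
  rw [map_zero]
  exact ((LinearMap.mem_graph_iff _ _).1 h).symm

theorem dualGraph_inj {n : ℕ} (Ω : Opens (Space n)) (s p : ℝ) [Fact (1 < p)]
    (F : SobolevDual Ω s p) (h : (F, 0) ∈ dualGraph Ω s p) : F = 0 := by
  have hdense : DenseRange (testInclZero Ω (-s) p.conjExponent) := by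
    rintro ⟨w, hw⟩
    rw [closure_subtype]
    refine closure_mono ?_ hw
    rintro _ ⟨φ, rfl⟩
    exact ⟨testInclZero Ω (-s) p.conjExponent φ, ⟨φ, rfl⟩, rfl⟩
  apply DFunLike.coe_injective
  refine hdense.equalizer F.continuous continuous_const ?_
  funext φ
  exact h φ

/-- The norm of `W^{s,p}(Ω)`, `s ∈ ℝ`, on distributions in this space. -/
noncomputable def sobolevNorm {n : ℕ} (Ω : Opens (Space n)) (s p : ℝ) [Fact (1 < p)]
    (u : 𝓓'(Ω, ℝ)) : ℝ :=
  open scoped Classical in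
  if 0 ≤ s then graphNorm (nonnegGraph Ω s p) u else graphNorm (dualGraph Ω s p) u

/-- The normed space `W^{s,p}(Ω)`, `s ∈ ℝ`. -/
def Sobolev {n : ℕ} (Ω : Opens (Space n)) (s p : ℝ) [Fact (1 < p)] : Type :=
  sobolevSubmodule Ω s p

namespace Sobolev

noncomputable instance {n : ℕ} (Ω : Opens (Space n)) (s p : ℝ) [Fact (1 < p)] :
    AddCommGroup (Sobolev Ω s p) :=
  inferInstanceAs (AddCommGroup (sobolevSubmodule Ω s p))

noncomputable instance {n : ℕ} (Ω : Opens (Space n)) (s p : ℝ) [Fact (1 < p)] :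
    Module ℝ (Sobolev Ω s p) :=
  inferInstanceAs (Module ℝ (sobolevSubmodule Ω s p))

/-- The inclusion of `W^{s,p}(Ω)` in the space of distributions. -/
noncomputable def toDistr {n : ℕ} {Ω : Opens (Space n)} {s p : ℝ} [Fact (1 < p)] :
    Sobolev Ω s p →ₗ[ℝ] 𝓓'(Ω, ℝ) :=
  (sobolevSubmodule Ω s p).subtype

noncomputable instance {n : ℕ} (Ω : Opens (Space n)) (s p : ℝ) [Fact (1 < p)] :
    Norm (Sobolev Ω s p) :=
  ⟨fun u => sobolevNorm Ω s p (toDistr u)⟩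

theorem core_of {n : ℕ} {Ω : Opens (Space n)} {s p : ℝ} [Fact (1 < p)] {X : Type}
    [NormedAddCommGroup X] [NormedSpace ℝ X] {R : DistrRel X Ω}
    (h1 : ∀ x, (x, 0) ∈ R → x = 0) (h2 : ∀ u, (0, u) ∈ R → u = 0)
    (h3 : ∀ u, sobolevNorm Ω s p u = graphNorm R u)
    (h4 : sobolevSubmodule Ω s p = R.map (LinearMap.snd ℝ _ _)) :
    NormedSpace.Core ℝ (Sobolev Ω s p) := by
  replace h3 (u : Sobolev Ω s p) : ‖u‖ = graphNorm R (toDistr u) := h3 _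
  replace h4 (u : Sobolev Ω s p) : ∃ x, (x, toDistr u) ∈ R := by
    have hu : toDistr u ∈ sobolevSubmodule Ω s p := u.2
    rw [h4] at hu
    obtain ⟨w, hw, hwu⟩ := hu
    exact ⟨w.1, by rw [← hwu]; exact hw⟩
  refine { norm_nonneg := fun u => ?_, norm_smul := fun c u => ?_, norm_triangle := fun u v => ?_,
           norm_eq_zero_iff := fun u => ⟨fun h => ?_, fun h => ?_⟩ }
  · obtain ⟨x, hx⟩ := h4 u
    rw [h3, graphNorm_eq h1 hx]
    exact norm_nonneg x
  · obtain ⟨x, hx⟩ := h4 u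
    rw [h3, h3, graphNorm_eq h1 hx, map_smul, graphNorm_eq h1 (R.smul_mem c hx)]
    exact norm_smul c x
  · obtain ⟨x, hx⟩ := h4 u
    obtain ⟨y, hy⟩ := h4 v
    rw [h3, h3, h3, graphNorm_eq h1 hx, graphNorm_eq h1 hy, map_add,
      graphNorm_eq h1 (R.add_mem hx hy)]
    exact norm_add_le x y
  · obtain ⟨x, hx⟩ := h4 u
    rw [h3, graphNorm_eq h1 hx, norm_eq_zero] at h
    exact Subtype.ext (h2 _ (h ▸ hx))
  · rw [h3, h, map_zero, graphNorm_eq h1 R.zero_mem]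
    exact norm_zero

theorem core {n : ℕ} (Ω : Opens (Space n)) (s p : ℝ) [Fact (1 < p)] :
    NormedSpace.Core ℝ (Sobolev Ω s p) := by
  by_cases hs : 0 ≤ s
  · exact core_of (nonnegGraph_inj Ω s p)
      (fun u hu => ((LinearMap.mem_graph_iff _ _).1 hu).trans (map_zero _))
      (fun u => if_pos hs) (if_pos hs)
  · refine core_of (dualGraph_inj Ω s p) (fun u hu => ?_) (fun u => if_neg hs) (if_neg hs)
    ext φ
    exact (hu φ).symm

noncomputable instance {n : ℕ} (Ω : Opens (Space n)) (s p : ℝ) [Fact (1 < p)] :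
    NormedAddCommGroup (Sobolev Ω s p) :=
  .ofCore (core Ω s p)

noncomputable instance {n : ℕ} (Ω : Opens (Space n)) (s p : ℝ) [Fact (1 < p)] :
    NormedSpace ℝ (Sobolev Ω s p) :=
  .ofCore (core Ω s p)

end Sobolev

/-- `(s, p, Ω)` is a smooth multiplication triple: for every `φ ∈ C_c^∞(Ω)`, the map `u ↦ φ u` is
well defined and bounded from `W^{s,p}(Ω)` to itself. -/
def IsSmoothMulTriple {n : ℕ} (s p : ℝ) [Fact (1 < p)] (Ω : Opens (Space n)) : Prop :=
  ∀ φ : 𝓓(Ω, ℝ), ∃ T : Sobolev Ω s p →L[ℝ] Sobolev Ω s p,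
    ∀ u, (T u).toDistr = mulDistr φ u.toDistr

/-- `W^{s₁,p₁}(U)` is compactly embedded in `W^{s₂,p₂}(U)`: it is contained in this space, and the
inclusion is a compact operator. -/
def IsCompactlyEmbedded {n : ℕ} (s₁ p₁ s₂ p₂ : ℝ) [Fact (1 < p₁)] [Fact (1 < p₂)]
    (U : Opens (Space n)) : Prop :=
  ∃ T : Sobolev U s₁ p₁ →L[ℝ] Sobolev U s₂ p₂,
    (∀ u, (T u).toDistr = u.toDistr) ∧ IsCompactOperator T

/-! ### Locally Sobolev functions -/

/-- The space `W^{s,p}_loc(Ω) = {u ∈ D'(Ω) : ∀ φ ∈ C_c^∞(Ω), φ u ∈ W^{s,p}(Ω)}`, as a subspace of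
the space of distributions. -/
noncomputable def sobolevLocSubmodule {n : ℕ} (Ω : Opens (Space n)) (s p : ℝ) [Fact (1 < p)] :
    Submodule ℝ 𝓓'(Ω, ℝ) :=
  ⨅ φ : 𝓓(Ω, ℝ), (sobolevSubmodule Ω s p).comap (mulDistr φ : 𝓓'(Ω, ℝ) →ₗ[ℝ] 𝓓'(Ω, ℝ))

/-- The topological vector space `W^{s,p}_loc(Ω)`. -/
def SobolevLoc {n : ℕ} (Ω : Opens (Space n)) (s p : ℝ) [Fact (1 < p)] : Type :=
  sobolevLocSubmodule Ω s p

namespace SobolevLoc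

noncomputable instance {n : ℕ} (Ω : Opens (Space n)) (s p : ℝ) [Fact (1 < p)] :
    AddCommGroup (SobolevLoc Ω s p) :=
  inferInstanceAs (AddCommGroup (sobolevLocSubmodule Ω s p))

noncomputable instance {n : ℕ} (Ω : Opens (Space n)) (s p : ℝ) [Fact (1 < p)] :
    Module ℝ (SobolevLoc Ω s p) :=
  inferInstanceAs (Module ℝ (sobolevLocSubmodule Ω s p))

/-- The inclusion of `W^{s,p}_loc(Ω)` in the space of distributions. -/
noncomputable def toDistr {n : ℕ} {Ω : Opens (Space n)} {s p : ℝ} [Fact (1 < p)] :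
    SobolevLoc Ω s p →ₗ[ℝ] 𝓓'(Ω, ℝ) :=
  (sobolevLocSubmodule Ω s p).subtype

/-- The map `u ↦ φ u` from `W^{s,p}_loc(Ω)` to `W^{s,p}(Ω)`, for `φ ∈ C_c^∞(Ω)`. -/
noncomputable def mulTo {n : ℕ} {Ω : Opens (Space n)} {s p : ℝ} [Fact (1 < p)] (φ : 𝓓(Ω, ℝ)) :
    SobolevLoc Ω s p →ₗ[ℝ] Sobolev Ω s p :=
  LinearMap.codRestrict (sobolevSubmodule Ω s p)
    ((mulDistr φ : 𝓓'(Ω, ℝ) →ₗ[ℝ] 𝓓'(Ω, ℝ)) ∘ₗ toDistr)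
    fun u => Submodule.mem_comap.1 ((Submodule.mem_iInf _).1 u.2 φ)

/-- The seminorms `|u|_{φ,s,p} = ‖φ u‖_{W^{s,p}(Ω)}`, `φ ∈ C_c^∞(Ω)`, on `W^{s,p}_loc(Ω)`. -/
noncomputable def seminorms {n : ℕ} (Ω : Opens (Space n)) (s p : ℝ) [Fact (1 < p)] :
    SeminormFamily ℝ (SobolevLoc Ω s p) 𝓓(Ω, ℝ) :=
  fun φ => (normSeminorm ℝ (Sobolev Ω s p)).comp (mulTo φ)

/-- The natural topology of `W^{s,p}_loc(Ω)`, induced by the seminorms `|·|_{φ,s,p}`. -/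
noncomputable instance {n : ℕ} (Ω : Opens (Space n)) (s p : ℝ) [Fact (1 < p)] :
    TopologicalSpace (SobolevLoc Ω s p) :=
  (seminorms Ω s p).moduleFilterBasis.topology

theorem withSeminorms {n : ℕ} (Ω : Opens (Space n)) (s p : ℝ) [Fact (1 < p)] :
    WithSeminorms (seminorms Ω s p) :=
  ⟨rfl⟩

end SobolevLoc

/-! ### Lipschitz domains -/

/-- `U` is a nonempty bounded open set with Lipschitz continuous boundary: near each boundary
point `x`, for a suitable unit vector `e`, the set `U` is the set of points lying below the graph,
in direction `e`, of a Lipschitz function on the hyperplane `e^⊥`. -/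
def IsLipschitzDomain {n : ℕ} (U : Opens (Space n)) : Prop :=
  (U : Set (Space n)).Nonempty ∧ Bornology.IsBounded (U : Set (Space n)) ∧
  ∀ x ∈ frontier (U : Set (Space n)), ∃ e : Space n, ‖e‖ = 1 ∧
    ∃ (g : (ℝ ∙ e)ᗮ → ℝ) (L : ℝ≥0), LipschitzWith L g ∧
      ∃ r > 0, ∀ y ∈ Metric.ball x r,
        y ∈ U ↔ inner ℝ e y < g ((ℝ ∙ e)ᗮ.orthogonalProjectionOnto y)

/-- The interior Lipschitz property: every compact subset of `Ω` is contained in a bounded open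
subset of `Ω` with Lipschitz continuous boundary. -/
def HasInteriorLipschitzProperty {n : ℕ} (Ω : Opens (Space n)) : Prop :=
  ∀ K : Set (Space n), IsCompact K → K ⊆ Ω →
    ∃ U : Opens (Space n), IsLipschitzDomain U ∧ U ≤ Ω ∧ K ⊆ U

end LocallySobolev

open LocallySobolev

namespace LocallySobolev

/-! ### Test functions: cut-offs, extension by zero, derivatives -/

/-! Fix a test function `φ` and a Lipschitz domain `U` with `supp φ ⊆ U ⊆ Ω`. The products `φ u_m`
are bounded in `W^{s₁,p₁}(Ω)` and supported in `supp φ`. They restrict boundedly to `W^{s₁,p₁}(U)`,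
the compact embedding puts them in a compact subset of `W^{s₂,p₂}(U)`, and extension by zero carries
this set to a compact subset of `W^{s₂,p₂}(Ω)` (`exists_isCompact_mulDistr`). A diagonal argument
over countably many cut-offs `η i` exhausting `Ω` gives a subsequence converging weakly to a
distribution `W` (`exists_tendsto_distr`). For any other `φ`, the products `φ u_m` along it stay in
a compact set, and their only possible limit is `φ W`, so they converge in norm.

The work lies in restriction and extension for every real order (`Sobolev.exists_restrict`,
`Sobolev.exists_extend`). For `s ≥ 0` restriction is trivial. If `u` vanishes off `K` and `χ = 1`
near `K`, the derivatives of the extension are `χ ∂^ν u`, without Leibniz terms, so the fractional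
seminorm is needed only for the top derivatives, where the norm contains it.

For `s < 0` both maps are dual to multiplication of test functions by `χ` in the `W^{-s,p'}` norms
(`exists_norm_testIncl_mul_le`). Here Leibniz terms do occur, and on a general open set the norm
contains no fractional seminorm of the lower derivatives. But a test function extends smoothly by
zero to `ℝⁿ`, where `W^{1,p} ⊆ W^{θ,p}` (`eLpNorm_diffQuot_le`) controls these terms at the cost of
one derivative. -/

theorem exists_test_eq_one_near {n : ℕ} {U : Opens (Space n)} {K : Set (Space n)}
    (hK : IsCompact K) (hKU : K ⊆ U) : ∃ χ : 𝓓(U, ℝ), ∀ x ∈ K, χ =ᶠ[𝓝 x] 1 := by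
  -- Two compact sets are interposed: the function equals one on `L`, a neighbourhood of `K`, and
  -- its support stays inside `L'`.
  obtain ⟨L, hL, hKL, hLU⟩ := exists_compact_between hK U.isOpen hKU
  obtain ⟨L', hL', hLL', hLU'⟩ := exists_compact_between hL U.isOpen hLU
  obtain ⟨f, hf, -, hfs, hf1⟩ := exists_contMDiff_support_eq_eq_one_iff (n := (⊤ : ℕ∞))
    (modelWithCornersSelf ℝ (Space n)) isOpen_interior hL.isClosed hLL'
  have hts : tsupport f ⊆ L' := by
    rw [tsupport, hfs]
    exact closure_minimal interior_subset hL'.isClosed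
  refine ⟨⟨f, hf.contDiff, hL'.of_isClosed_subset (isClosed_tsupport f) hts,
    hts.trans hLU'⟩, fun x hx => ?_⟩
  filter_upwards [mem_interior_iff_mem_nhds.1 (hKL hx)] with y hy
  exact (hf1 y).1 hy

theorem lineDeriv_test_apply {n : ℕ} {Ω : Opens (Space n)} (v : Space n) (f : 𝓓(Ω, ℝ))
    (x : Space n) : (TestFunction.lineDerivCLM ℝ v f : 𝓓(Ω, ℝ)) x = fderiv ℝ f x v := by
  rw [TestFunction.lineDerivCLM_eq_fderivCLM, TestFunction.fderivCLM_apply_of_le _ (by simp)]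

theorem differentiable_test {n : ℕ} {Ω : Opens (Space n)} (f : 𝓓(Ω, ℝ)) : Differentiable ℝ f :=
  f.contDiff.differentiable (by simp)

theorem mulTest_apply {n : ℕ} {Ω : Opens (Space n)} (φ ψ : 𝓓(Ω, ℝ)) (x : Space n) :
    mulTest φ ψ x = ψ x * φ x := rfl

/-- Symmetry of the second derivative. It is needed because `partialTest` is a product in a fixed
order, into which a further derivative has to be sorted. -/
theorem lineDeriv_test_comm {n : ℕ} {Ω : Opens (Space n)} (v w : Space n) :
    Commute (TestFunction.lineDerivCLM ℝ v : 𝓓(Ω, ℝ) →L[ℝ] 𝓓(Ω, ℝ))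
      (TestFunction.lineDerivCLM ℝ w) := by
  refine ContinuousLinearMap.ext fun f => TestFunction.ext fun x => ?_
  have h2 : (2 : WithTop ℕ∞) ≤ ((⊤ : ℕ∞) : WithTop ℕ∞) :=
    WithTop.coe_le_coe.2 (le_top : (2 : ℕ∞) ≤ ⊤)
  have hd : DifferentiableAt ℝ (fderiv ℝ f) x :=
    (f.contDiff.fderiv_right (m := 1) (by rwa [one_add_one_eq_two])).differentiable (by simp) x
  have key (a b : Space n) : (TestFunction.lineDerivCLM ℝ a
      (TestFunction.lineDerivCLM ℝ b f : 𝓓(Ω, ℝ)) : 𝓓(Ω, ℝ)) x =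
        fderiv ℝ (fderiv ℝ f) x a b := by
    rw [lineDeriv_test_apply]
    have : ⇑(TestFunction.lineDerivCLM ℝ b f : 𝓓(Ω, ℝ)) = fun y => fderiv ℝ f y b :=
      funext fun y => lineDeriv_test_apply b f y
    rw [this, fderiv_clm_apply hd (differentiableAt_const b)]
    simp
  change (TestFunction.lineDerivCLM ℝ v (TestFunction.lineDerivCLM ℝ w f : 𝓓(Ω, ℝ)) : 𝓓(Ω, ℝ)) x =
    (TestFunction.lineDerivCLM ℝ w (TestFunction.lineDerivCLM ℝ v f : 𝓓(Ω, ℝ)) : 𝓓(Ω, ℝ)) x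
  rw [key, key]
  exact f.contDiff.contDiffAt.isSymmSndFDerivAt (by simpa using h2) v w

/-- A relation respected by families of operators is respected by their monomials. -/
theorem rel_prod_pow {ι X Y : Type*} [AddCommGroup X] [Module ℝ X] [TopologicalSpace X]
    [AddCommGroup Y] [Module ℝ Y] [TopologicalSpace Y] {a : ι → X →L[ℝ] X} {b : ι → Y →L[ℝ] Y}
    {R : X → Y → Prop} (hR : ∀ i x y, R x y → R (a i x) (b i y)) (ν : ι → ℕ) (l : List ι)
    {x : X} {y : Y} (hxy : R x y) :
    R ((l.map fun i => a i ^ ν i).prod x) ((l.map fun i => b i ^ ν i).prod y) := by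
  have hpow (i : ι) (m : ℕ) {x : X} {y : Y} (hxy : R x y) : R ((a i ^ m) x) ((b i ^ m) y) := by
    induction m with
    | zero => exact hxy
    | succ m ih =>
      rw [pow_succ', pow_succ', mul_apply_eq_comp, mul_apply_eq_comp]
      exact hR i _ _ ih
  induction l with
  | nil => exact hxy
  | cons i l ih =>
    rw [List.map_cons, List.map_cons, List.prod_cons, List.prod_cons,
      mul_apply_eq_comp, mul_apply_eq_comp]
    exact hpow i _ ih

/-- Derivatives depend only on the underlying function, not on the open set recorded in the type;
this lets estimates pass from `A` to `B`. -/
theorem partialTest_congr {n : ℕ} {A B : Opens (Space n)} (ν : Fin n → ℕ) {f : 𝓓(A, ℝ)}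
    {g : 𝓓(B, ℝ)} (h : (f : Space n → ℝ) = g) :
    (partialTest ν f : Space n → ℝ) = partialTest ν g :=
  rel_prod_pow (R := fun (f : 𝓓(A, ℝ)) (g : 𝓓(B, ℝ)) => (f : Space n → ℝ) = g)
    (fun i f g h => funext fun x => by rw [lineDeriv_test_apply, lineDeriv_test_apply, h]) ν _ h

/-- The extra factor commutes past the others to the front. The case `i ∉ l` serves the induction,
and `Nodup` ensures that the exponent of `a i` is raised only once. -/
theorem prod_pow_single_add {ι M : Type*} [Monoid M] [DecidableEq ι] {a : ι → M}
    (ha : ∀ i j, Commute (a i) (a j)) (ν : ι → ℕ) (i : ι) {l : List ι} (hl : l.Nodup) :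
    (l.map fun j => a j ^ (ν + Pi.single i 1 : ι → ℕ) j).prod =
      if i ∈ l then a i * (l.map fun j => a j ^ ν j).prod
      else (l.map fun j => a j ^ ν j).prod := by
  induction l with
  | nil => rfl
  | cons j l ih =>
    rw [List.nodup_cons] at hl
    rw [List.map_cons, List.prod_cons, ih hl.2, List.map_cons, List.prod_cons]
    by_cases hij : i = j
    · subst hij
      rw [if_neg hl.1, if_pos (by simp)]
      simp [pow_succ', mul_assoc]
    · have hν : (ν + Pi.single i 1 : ι → ℕ) j = ν j := by
        simp [Pi.single_eq_of_ne (Ne.symm hij)]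
      rw [hν]
      by_cases hil : i ∈ l
      · rw [if_pos hil, if_pos (by simp [hil]), ← mul_assoc, ← mul_assoc,
          ((ha i j).pow_right (ν j)).eq]
      · rw [if_neg hil, if_neg (by simp [hil, hij])]

theorem lineDeriv_partialTest {n : ℕ} {Ω : Opens (Space n)} (ν : Fin n → ℕ) (i : Fin n)
    (f : 𝓓(Ω, ℝ)) :
    (TestFunction.lineDerivCLM ℝ (EuclideanSpace.single i (1 : ℝ)) (partialTest ν f) : 𝓓(Ω, ℝ)) =
      partialTest (ν + Pi.single i 1) f := by
  unfold partialTest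
  rw [prod_pow_single_add (fun _ _ => lineDeriv_test_comm _ _) ν i (List.nodup_finRange n),
    if_pos (List.mem_finRange i)]
  rfl

/-! ### The Leibniz rule, as an order count for differential operators -/

/-- Linear differential operators of order at most `m` whose coefficients are test functions. -/
noncomputable def diffOp {n : ℕ} (Ω : Opens (Space n)) (m : ℕ) :
    Submodule ℝ (𝓓(Ω, ℝ) →ₗ[ℝ] 𝓓(Ω, ℝ)) :=
  Submodule.span ℝ {T | ∃ (c : 𝓓(Ω, ℝ)) (β : Fin n → ℕ), ∑ i, β i ≤ m ∧
    T = (mulTest c ∘L partialTest β : 𝓓(Ω, ℝ) →L[ℝ] 𝓓(Ω, ℝ))}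

/-- On generators, `∂ᵢ(c ∂^β ψ) = c ∂ᵢ∂^β ψ + (∂ᵢ c) ∂^β ψ`, and both coefficients are again test
functions. -/
theorem lineDeriv_comp_mem_diffOp {n : ℕ} {Ω : Opens (Space n)} {m : ℕ} (i : Fin n)
    {T : 𝓓(Ω, ℝ) →ₗ[ℝ] 𝓓(Ω, ℝ)} (hT : T ∈ diffOp Ω m) :
    ((TestFunction.lineDerivCLM ℝ (EuclideanSpace.single i (1 : ℝ)) :
      𝓓(Ω, ℝ) →L[ℝ] 𝓓(Ω, ℝ)) : 𝓓(Ω, ℝ) →ₗ[ℝ] 𝓓(Ω, ℝ)) ∘ₗ T ∈ diffOp Ω (m + 1) := by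
  set D : 𝓓(Ω, ℝ) →L[ℝ] 𝓓(Ω, ℝ) :=
    TestFunction.lineDerivCLM ℝ (EuclideanSpace.single i (1 : ℝ)) with hD
  induction hT using Submodule.span_induction with
  | mem T hT =>
    obtain ⟨c, β, hβ, rfl⟩ := hT
    have : (D : 𝓓(Ω, ℝ) →ₗ[ℝ] 𝓓(Ω, ℝ)) ∘ₗ
        (mulTest c ∘L partialTest β : 𝓓(Ω, ℝ) →L[ℝ] 𝓓(Ω, ℝ)) =
          ((mulTest c ∘L partialTest (β + Pi.single i 1) : 𝓓(Ω, ℝ) →L[ℝ] 𝓓(Ω, ℝ)) :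
            𝓓(Ω, ℝ) →ₗ[ℝ] 𝓓(Ω, ℝ)) +
          ((mulTest (D c) ∘L partialTest β : 𝓓(Ω, ℝ) →L[ℝ] 𝓓(Ω, ℝ)) :
            𝓓(Ω, ℝ) →ₗ[ℝ] 𝓓(Ω, ℝ)) := by
      refine LinearMap.ext fun ψ => TestFunction.ext fun x => ?_
      change D (mulTest c (partialTest β ψ)) x =
        partialTest (β + Pi.single i 1) ψ x * c x + partialTest β ψ x * D c x
      rw [← lineDeriv_partialTest, hD, lineDeriv_test_apply, lineDeriv_test_apply,
        lineDeriv_test_apply]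
      have : ⇑(mulTest c (partialTest β ψ)) = ⇑(partialTest β ψ) * ⇑c := rfl
      rw [this, fderiv_mul (differentiable_test _ x) (differentiable_test _ x)]
      simp only [add_apply, smul_apply, smul_eq_mul]
      ring
    rw [this]
    refine add_mem (Submodule.subset_span ⟨c, _, ?_, rfl⟩)
      (Submodule.subset_span ⟨D c, β, hβ.trans (Nat.le_succ m), rfl⟩)
    simp only [Pi.add_apply, Finset.sum_add_distrib, Finset.sum_pi_single', Finset.mem_univ, if_true]
    omega
  | zero => rw [LinearMap.comp_zero]; exact zero_mem _
  | add S T _ _ hS hT => rw [LinearMap.comp_add]; exact add_mem hS hT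
  | smul r T _ hT => rw [LinearMap.comp_smul]; exact Submodule.smul_mem _ r hT

/-- A Leibniz rule without binomial coefficients: the norm bounds only use the order of the terms
and that their coefficients are test functions. -/
theorem partialTest_comp_mulTest_mem_diffOp {n : ℕ} {Ω : Opens (Space n)} (ν : Fin n → ℕ)
    (c : 𝓓(Ω, ℝ)) :
    ((partialTest ν ∘L mulTest c : 𝓓(Ω, ℝ) →L[ℝ] 𝓓(Ω, ℝ)) : 𝓓(Ω, ℝ) →ₗ[ℝ] 𝓓(Ω, ℝ)) ∈
      diffOp Ω (∑ i, ν i) := by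
  set D : Fin n → 𝓓(Ω, ℝ) →L[ℝ] 𝓓(Ω, ℝ) := fun i =>
    TestFunction.lineDerivCLM ℝ (EuclideanSpace.single i (1 : ℝ)) with hD
  have hpow (i : Fin n) (k m : ℕ) (T : 𝓓(Ω, ℝ) →L[ℝ] 𝓓(Ω, ℝ))
      (hT : (T : 𝓓(Ω, ℝ) →ₗ[ℝ] 𝓓(Ω, ℝ)) ∈ diffOp Ω m) :
      ((D i ^ k * T : 𝓓(Ω, ℝ) →L[ℝ] 𝓓(Ω, ℝ)) : 𝓓(Ω, ℝ) →ₗ[ℝ] 𝓓(Ω, ℝ)) ∈ diffOp Ω (k + m) := by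
    induction k with
    | zero => rwa [pow_zero, one_mul, zero_add]
    | succ k ih =>
      rw [pow_succ', mul_assoc, Nat.succ_add]
      exact lineDeriv_comp_mem_diffOp i ih
  have hlist (l : List (Fin n)) : (((l.map fun i => D i ^ ν i).prod * mulTest c :
      𝓓(Ω, ℝ) →L[ℝ] 𝓓(Ω, ℝ)) : 𝓓(Ω, ℝ) →ₗ[ℝ] 𝓓(Ω, ℝ)) ∈ diffOp Ω (l.map ν).sum := by
    induction l with
    | nil =>
      refine Submodule.subset_span ⟨c, 0, by simp, LinearMap.ext fun ψ => ?_⟩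
      have : partialTest (0 : Fin n → ℕ) ψ = ψ := partialTest_zero (k := 0) ψ
      change mulTest c ψ = mulTest c (partialTest 0 ψ)
      rw [this]
    | cons i l ih =>
      rw [List.map_cons, List.map_cons, List.prod_cons, List.sum_cons, mul_assoc]
      exact hpow i _ _ _ ih
  have := hlist (List.finRange n)
  rwa [← List.ofFn_eq_map, List.sum_ofFn] at this

/-! ### Cutting off, restricting and extending distributions between open sets -/

/-- Multiplication by a test function on `U`, from test functions on `V` to test functions on
`U`. -/
noncomputable def cutTest {n : ℕ} {U : Opens (Space n)} (V : Opens (Space n)) (χ : 𝓓(U, ℝ)) :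
    𝓓(V, ℝ) →L[ℝ] 𝓓(U, ℝ) :=
  TestFunction.limitCLM ℝ
    (fun ψ => ⟨fun x => ψ x * χ x, ψ.contDiff.mul χ.contDiff, χ.hasCompactSupport.mul_left,
      (tsupport_mul_subset_right).trans χ.tsupport_subset⟩)
    -- Whatever `K` is, the products are supported in the fixed compact set `tsupport χ`, which lies
    -- in `U`.
    (fun K hK => TestFunction.ofSupportedInCLM ℝ (K := ⟨tsupport χ, χ.hasCompactSupport⟩)
        χ.tsupport_subset ∘L
      { toFun := fun ψ => ⟨fun x => ψ x * χ x, ψ.contDiff.mul χ.contDiff, fun x hx => by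
          change ψ x * χ x = 0
          rw [image_eq_zero_of_notMem_tsupport hx, mul_zero]⟩
        map_add' := fun f g => by ext x; exact add_mul (f x) (g x) (χ x)
        map_smul' := fun r f => by ext x; exact mul_assoc r (f x) (χ x)
        cont := by
          -- The structure maps see only the function and its derivatives, not the compact set of
          -- the type; so continuity is inherited from the same product regarded as supported in
          -- `K`.
          refine (ContDiffMapSupportedIn.continuous_iff_comp _).2 fun i => ?_
          refine ((ContDiffMapSupportedIn.structureMapCLM ℝ ⊤ i).continuous.comp
            (ContDiffMapSupportedIn.bilinLeftCLM (K := K) (n := ⊤) (ContinuousLinearMap.mul ℝ ℝ)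
              χ.contDiff).continuous).congr fun ψ => ?_
          ext1 x
          simp only [Function.comp_apply, ContDiffMapSupportedIn.structureMapCLM_top_apply]
          rfl })
    (fun _ _ _ => rfl)

theorem cutTest_apply {n : ℕ} {U V : Opens (Space n)} (χ : 𝓓(U, ℝ)) (ψ : 𝓓(V, ℝ)) (x : Space n) :
    cutTest V χ ψ x = ψ x * χ x := rfl

/-- A test function on `U`, as a test function on a larger open set. -/
noncomputable def inclTest {n : ℕ} (U V : Opens (Space n)) : 𝓓(U, ℝ) →L[ℝ] 𝓓(V, ℝ) :=
  TestFunction.monoCLM ℝ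

/-- `monoCLM` is defined by cases on the inclusion of the open sets, so `inclTest` is the expected
map only when `U ≤ V`. -/
theorem coe_inclTest {n : ℕ} {U V : Opens (Space n)} (h : U ≤ V) (ψ : 𝓓(U, ℝ)) :
    (inclTest U V ψ : Space n → ℝ) = ψ := by
  rw [inclTest, TestFunction.monoCLM_apply, if_pos ⟨le_rfl, h⟩]

/-- Restriction of distributions on `V` to a smaller open set. -/
noncomputable def resDistr {n : ℕ} (U V : Opens (Space n)) : 𝓓'(V, ℝ) →L[ℝ] 𝓓'(U, ℝ) :=
  (inclTest U V).precompCompactConvergenceCLM ℝ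

theorem resDistr_apply {n : ℕ} {U V : Opens (Space n)} (u : 𝓓'(V, ℝ)) (ψ : 𝓓(U, ℝ)) :
    resDistr U V u ψ = u (inclTest U V ψ) := rfl

/-- The extension `ψ ↦ u (χ ψ)` of a distribution on `U`, cut off by a test function `χ`. -/
noncomputable def extDistr {n : ℕ} {U : Opens (Space n)} (V : Opens (Space n)) (χ : 𝓓(U, ℝ)) :
    𝓓'(U, ℝ) →L[ℝ] 𝓓'(V, ℝ) :=
  (cutTest V χ).precompCompactConvergenceCLM ℝ

theorem extDistr_apply {n : ℕ} {U V : Opens (Space n)} (χ : 𝓓(U, ℝ)) (u : 𝓓'(U, ℝ))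
    (ψ : 𝓓(V, ℝ)) : extDistr V χ u ψ = u (cutTest V χ ψ) := rfl

/-- The distribution `u` vanishes on test functions whose support does not meet `K`. -/
def VanishesOff {n : ℕ} {U : Opens (Space n)} (K : Set (Space n)) (u : 𝓓'(U, ℝ)) : Prop :=
  ∀ ψ : 𝓓(U, ℝ), (∀ x ∈ K, ψ =ᶠ[𝓝 x] 0) → u ψ = 0

theorem lineDeriv_test_eventuallyEq_zero {n : ℕ} {U : Opens (Space n)} (v : Space n)
    {ψ : 𝓓(U, ℝ)} {x : Space n} (h : ψ =ᶠ[𝓝 x] 0) :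
    (TestFunction.lineDerivCLM ℝ v ψ : 𝓓(U, ℝ)) =ᶠ[𝓝 x] 0 := by
  filter_upwards [h.eventuallyEq_nhds] with y hy
  rw [lineDeriv_test_apply, hy.fderiv_eq]
  simp

theorem resDistr_lineDeriv {n : ℕ} {U V : Opens (Space n)} (h : U ≤ V) (v : Space n)
    (u : 𝓓'(V, ℝ)) :
    resDistr U V (Distribution.lineDerivCLM v u) = Distribution.lineDerivCLM v (resDistr U V u) := by
  ext ψ
  rw [resDistr_apply, Distribution.lineDerivCLM_apply, Distribution.lineDerivCLM_apply,
    resDistr_apply]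
  congr 2
  refine TestFunction.ext fun x => ?_
  rw [lineDeriv_test_apply, coe_inclTest h, coe_inclTest h, lineDeriv_test_apply]

theorem resDistr_partialDistr {n : ℕ} {U V : Opens (Space n)} (h : U ≤ V) (ν : Fin n → ℕ)
    (u : 𝓓'(V, ℝ)) :
    resDistr U V (partialDistr ν u) = partialDistr ν (resDistr U V u) :=
  rel_prod_pow (R := fun (u : 𝓓'(V, ℝ)) (w : 𝓓'(U, ℝ)) => resDistr U V u = w)
    (fun i u w hw => by rw [resDistr_lineDeriv h, hw]) ν _ rfl

theorem VanishesOff.lineDeriv {n : ℕ} {U : Opens (Space n)} {K : Set (Space n)} {u : 𝓓'(U, ℝ)}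
    (hu : VanishesOff K u) (v : Space n) :
    VanishesOff K (Distribution.lineDerivCLM v u : 𝓓'(U, ℝ)) := by
  intro ψ hψ
  rw [Distribution.lineDerivCLM_apply, hu, neg_zero]
  exact fun x hx => lineDeriv_test_eventuallyEq_zero v (hψ x hx)

/-- The two sides differ by `u` applied to `ψ ∂χ` up to sign, and this function vanishes near `K`
because `χ = 1` there. -/
theorem extDistr_lineDeriv {n : ℕ} {U V : Opens (Space n)} {K : Set (Space n)}
    {χ : 𝓓(U, ℝ)} (hχ : ∀ x ∈ K, χ =ᶠ[𝓝 x] 1) {u : 𝓓'(U, ℝ)} (hu : VanishesOff K u)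
    (v : Space n) :
    extDistr V χ (Distribution.lineDerivCLM v u) = Distribution.lineDerivCLM v (extDistr V χ u) := by
  ext ψ
  rw [extDistr_apply, Distribution.lineDerivCLM_apply, Distribution.lineDerivCLM_apply,
    extDistr_apply, neg_inj, ← sub_eq_zero, ← map_sub]
  refine hu _ fun x hx => ?_
  have h1 : cutTest V χ ψ =ᶠ[𝓝 x] ψ := by
    filter_upwards [hχ x hx] with y hy
    rw [cutTest_apply, hy, Pi.one_apply, mul_one]
  filter_upwards [hχ x hx, h1.eventuallyEq_nhds] with y hy hy'
  change (TestFunction.lineDerivCLM ℝ v (cutTest V χ ψ) : 𝓓(U, ℝ)) y -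
    (TestFunction.lineDerivCLM ℝ v ψ : 𝓓(V, ℝ)) y * χ y = 0
  rw [lineDeriv_test_apply, lineDeriv_test_apply, hy, hy'.fderiv_eq, Pi.one_apply, mul_one, sub_self]

/-- Both claims are carried together: commuting the next derivative with the extension requires that
the derivatives taken so far vanish off `K`. -/
theorem VanishesOff.partialDistr {n : ℕ} {U V : Opens (Space n)} {K : Set (Space n)}
    {χ : 𝓓(U, ℝ)} (hχ : ∀ x ∈ K, χ =ᶠ[𝓝 x] 1) {u : 𝓓'(U, ℝ)} (hu : VanishesOff K u)
    (ν : Fin n → ℕ) : VanishesOff K (partialDistr ν u) ∧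
      extDistr V χ (LocallySobolev.partialDistr ν u) =
        LocallySobolev.partialDistr ν (extDistr V χ u) :=
  rel_prod_pow (R := fun (u : 𝓓'(U, ℝ)) (w : 𝓓'(V, ℝ)) => VanishesOff K u ∧ extDistr V χ u = w)
    (fun i u w hw => ⟨hw.1.lineDeriv _, by rw [extDistr_lineDeriv hχ hw.1, hw.2]⟩) ν _ ⟨hu, rfl⟩

/-! ### Estimates of difference quotients -/

theorem lintegral_enorm_rpow_eq {α F : Type*} [MeasurableSpace α] [NormedAddCommGroup F]
    {μ : Measure α} {p : ℝ} (hp : 1 < p) (f : α → F) :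
    ∫⁻ x, ‖f x‖ₑ ^ p ∂μ = eLpNorm f (ENNReal.ofReal p) μ ^ p := by
  have hp0 : 0 < p := by linarith
  rw [eLpNorm_eq_lintegral_rpow_enorm_toReal (by simpa) (by simp),
    ENNReal.toReal_ofReal hp0.le, ← ENNReal.rpow_mul, one_div_mul_cancel hp0.ne', ENNReal.rpow_one]

theorem eLpNorm_le_of_lintegral_enorm_rpow_le {α F : Type*} [MeasurableSpace α]
    [NormedAddCommGroup F] {μ : Measure α} {p : ℝ} (hp : 1 < p) {f : α → F} {C : ℝ≥0∞}
    (h : ∫⁻ x, ‖f x‖ₑ ^ p ∂μ ≤ C ^ p) : eLpNorm f (ENNReal.ofReal p) μ ≤ C := by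
  rwa [lintegral_enorm_rpow_eq hp, ENNReal.rpow_le_rpow_iff (by linarith)] at h

/-- The kernel dominating the difference quotients of smooth functions. -/
noncomputable def quotKernel {n : ℕ} (p θ : ℝ) (h : Space n) : ℝ :=
  min ‖h‖ 1 / ‖h‖ ^ (n / p + θ)

/-- The numerator `min ‖h‖ 1` gives integrability at the origin because `θ < 1`; at infinity `θ > 0`
is what matters. -/
theorem eLpNorm_quotKernel_lt_top {n : ℕ} {p θ : ℝ} (hp : 1 < p) (h0 : 0 < θ) (h1 : θ < 1) :
    eLpNorm (quotKernel (n := n) p θ) (ENNReal.ofReal p) volume < ∞ := by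
  have hp0 : 0 < p := by linarith
  have h := (kernel_integrable (n := n) hp h0 h1).2
  refine ((ENNReal.rpow_lt_top_iff_of_pos hp0).1 ?_)
  rw [← lintegral_enorm_rpow_eq hp]
  rw [hasFiniteIntegral_iff_enorm] at h
  convert h using 3 with z
  rw [Real.enorm_rpow_of_nonneg (by positivity) hp0.le]
  rfl

theorem measurable_quotKernel {n : ℕ} {p θ : ℝ} : Measurable (quotKernel (n := n) p θ) := by
  unfold quotKernel
  fun_prop

theorem exists_abs_sub_le_min {n : ℕ} {Ω : Opens (Space n)} (φ : 𝓓(Ω, ℝ)) :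
    ∃ C : ℝ, 0 ≤ C ∧ ∀ x y, |φ x - φ y| ≤ C * min ‖x - y‖ 1 := by
  obtain ⟨C₁, hC₁⟩ := φ.contDiff.lipschitzWith_of_hasCompactSupport φ.hasCompactSupport (by simp)
  obtain ⟨C₂, hC₂⟩ := φ.hasCompactSupport.exists_bound_of_continuous φ.continuous
  have hC₂0 : 0 ≤ C₂ := (norm_nonneg _).trans (hC₂ 0)
  refine ⟨C₁ + 2 * C₂, by positivity, fun x y => ?_⟩
  rw [← Real.norm_eq_abs]
  rcases le_total ‖x - y‖ 1 with h | h
  · rw [min_eq_left h]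
    have := hC₁.norm_sub_le x y
    nlinarith [norm_nonneg (x - y)]
  · rw [min_eq_right h]
    have := (norm_sub_le (φ x) (φ y)).trans (add_le_add (hC₂ x) (hC₂ y))
    have : (0 : ℝ) ≤ C₁ := C₁.2
    linarith

theorem norm_diffQuot_le {n : ℕ} {p θ C : ℝ} {c : Space n → ℝ}
    (hc : ∀ x y, |c x - c y| ≤ C * min ‖x - y‖ 1) (z : Space n × Space n) :
    ‖diffQuot p θ c z‖ ≤ C * ‖quotKernel p θ (z.1 - z.2)‖ := by
  rw [diffQuot, quotKernel, norm_div, norm_div, ← mul_div_assoc, Real.norm_eq_abs (c z.1 - c z.2),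
    Real.norm_of_nonneg (by positivity : 0 ≤ min ‖z.1 - z.2‖ 1)]
  exact div_le_div_of_nonneg_right (hc _ _) (norm_nonneg _)

/-- The integrand is dominated by `|g(x)|^p` times a function of `x - y`, whose integral over `y`
does not depend on `x`. The inequality half of Tonelli suffices, so `g` need not be measurable. -/
theorem eLpNorm_fst_mul_diffQuot_le {n : ℕ} {p θ C : ℝ} (hp : 1 < p) (h0 : 0 < θ) (h1 : θ < 1)
    {c : Space n → ℝ}
    (hc : ∀ x y, |c x - c y| ≤ C * min ‖x - y‖ 1) (g : Space n → ℝ) :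
    eLpNorm (fun z : Space n × Space n => g z.1 * diffQuot p θ c z) (ENNReal.ofReal p)
      (volume.prod volume) ≤ ENNReal.ofReal C *
        eLpNorm (quotKernel (n := n) p θ) (ENNReal.ofReal p) volume *
          eLpNorm g (ENNReal.ofReal p) volume := by
  have hp0 : 0 ≤ p := by linarith
  refine eLpNorm_le_of_lintegral_enorm_rpow_le hp ?_
  set k : Space n → ℝ≥0∞ := fun h => ‖quotKernel p θ h‖ₑ ^ p with hk
  have hK : ∫⁻ y, k y ≠ ∞ := by
    rw [hk, lintegral_enorm_rpow_eq hp]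
    exact ENNReal.rpow_ne_top_of_nonneg hp0 (eLpNorm_quotKernel_lt_top hp h0 h1).ne
  have hpt (z : Space n × Space n) : ‖g z.1 * diffQuot p θ c z‖ₑ ^ p ≤
      ENNReal.ofReal C ^ p * (‖g z.1‖ₑ ^ p * k (z.1 - z.2)) := by
    rw [enorm_mul, ENNReal.mul_rpow_of_nonneg _ _ hp0, mul_left_comm]
    refine mul_le_mul_right ?_ _
    simp only [hk]
    rw [← ENNReal.mul_rpow_of_nonneg _ _ hp0]
    gcongr
    rw [← ofReal_norm (diffQuot p θ c z), ← ofReal_norm (quotKernel p θ (z.1 - z.2)),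
      ← ENNReal.ofReal_mul' (norm_nonneg _)]
    exact ENNReal.ofReal_le_ofReal (norm_diffQuot_le hc z)
  calc ∫⁻ z : Space n × Space n, ‖g z.1 * diffQuot p θ c z‖ₑ ^ p ∂(volume.prod volume)
      ≤ ∫⁻ z : Space n × Space n, ENNReal.ofReal C ^ p * (‖g z.1‖ₑ ^ p * k (z.1 - z.2))
          ∂(volume.prod volume) := lintegral_mono hpt
    _ ≤ ∫⁻ x : Space n, ∫⁻ y : Space n, ENNReal.ofReal C ^ p * (‖g x‖ₑ ^ p * k (x - y)) :=
        lintegral_prod_le _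
    _ = ∫⁻ x : Space n, ENNReal.ofReal C ^ p * (‖g x‖ₑ ^ p * ∫⁻ y, k y) := by
        refine lintegral_congr fun x => ?_
        rw [lintegral_const_mul' _ _ (by finiteness), lintegral_const_mul' _ _ (by finiteness),
          lintegral_sub_left_eq_self]
    _ = ENNReal.ofReal C ^ p * ((∫⁻ x, ‖g x‖ₑ ^ p) * ∫⁻ y, k y) := by
        rw [lintegral_const_mul' _ _ (by finiteness)]
        rw [lintegral_mul_const' _ _ hK]
    _ = _ := by
        rw [lintegral_enorm_rpow_eq hp, hk, lintegral_enorm_rpow_eq hp,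
          ENNReal.mul_rpow_of_nonneg _ _ hp0, ENNReal.mul_rpow_of_nonneg _ _ hp0, mul_assoc,
          mul_comm (eLpNorm g _ _ ^ p)]

theorem aestronglyMeasurable_diffQuot {n : ℕ} {p θ : ℝ} {g : Space n → ℝ} {μ : Measure (Space n)}
    [SFinite μ] (hg : AEStronglyMeasurable g μ) :
    AEStronglyMeasurable (diffQuot p θ g) (μ.prod μ) := by
  have h1 : AEMeasurable (fun z : Space n × Space n => g z.1) (μ.prod μ) :=
    hg.aemeasurable.comp_quasiMeasurePreserving Measure.quasiMeasurePreserving_fst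
  have h2 : AEMeasurable (fun z : Space n × Space n => g z.2) (μ.prod μ) :=
    hg.aemeasurable.comp_quasiMeasurePreserving Measure.quasiMeasurePreserving_snd
  have h3 : Measurable fun z : Space n × Space n => ‖z.1 - z.2‖ ^ (n / p + θ) := by fun_prop
  exact ((h1.sub h2).div h3.aemeasurable).aestronglyMeasurable

/-- Write `c(x)g(x) - c(y)g(y) = c(x)(g(x) - g(y)) + g(y)(c(x) - c(y))`. If one of the points lies
outside `A`, then `c` vanishes there and a term of the second kind is all that remains. Hence the
left side may be taken over the whole space while the right side sees only `A`: this is extension by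
zero. -/
theorem eLpNorm_diffQuot_mul_le {n : ℕ} {p θ : ℝ} (hp : 1 < p) (h0 : 0 < θ) (h1 : θ < 1)
    {A : Opens (Space n)} (c : 𝓓(A, ℝ)) :
    ∃ C : ℝ≥0, ∀ g : Space n → ℝ, AEStronglyMeasurable g (vol A) →
      eLpNorm (diffQuot p θ fun x => c x * g x) (ENNReal.ofReal p) (volume.prod volume) ≤
        C * (eLpNorm (diffQuot p θ g) (ENNReal.ofReal p) ((vol A).prod (vol A)) +
          eLpNorm g (ENNReal.ofReal p) (vol A)) := by
  have hp1 : (1 : ℝ≥0∞) ≤ ENNReal.ofReal p := ENNReal.one_le_ofReal.2 hp.le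
  obtain ⟨M, hM⟩ := c.hasCompactSupport.exists_bound_of_continuous c.continuous
  obtain ⟨C, hC0, hC⟩ := exists_abs_sub_le_min c
  set K : ℝ≥0∞ := ENNReal.ofReal C * eLpNorm (quotKernel (n := n) p θ) (ENNReal.ofReal p) volume
    with hK
  have hKt : K ≠ ∞ := ENNReal.mul_ne_top (by simp) (eLpNorm_quotKernel_lt_top hp h0 h1).ne
  -- `M` bounds `|c|`. The term `F₂` occurs twice, also with its variables swapped, since either
  -- point may be the one in `A`.
  refine ⟨M.toNNReal + 2 * K.toNNReal, fun g hg => ?_⟩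
  have hA := A.isOpen.measurableSet
  set G : Space n → ℝ := (A : Set (Space n)).indicator g with hG
  have hGm : AEStronglyMeasurable G volume := (aestronglyMeasurable_indicator_iff hA).2 hg
  have hGn : eLpNorm G (ENNReal.ofReal p) volume = eLpNorm g (ENNReal.ofReal p) (vol A) :=
    eLpNorm_indicator_eq_eLpNorm_restrict hA
  have hc0 {x : Space n} (hx : x ∉ A) : c x = 0 :=
    image_eq_zero_of_notMem_tsupport fun h => hx (c.tsupport_subset h)
  set F₁ : Space n × Space n → ℝ := fun z =>
    M * ((A : Set (Space n)) ×ˢ (A : Set (Space n))).indicator (diffQuot p θ g) z with hF₁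
  set F₂ : Space n × Space n → ℝ := fun z => G z.1 * diffQuot p θ c z with hF₂
  have hF₁m : AEStronglyMeasurable F₁ (volume.prod volume) := by
    refine AEStronglyMeasurable.const_mul
      ((aestronglyMeasurable_indicator_iff (hA.prod hA)).2 ?_) M
    rw [← Measure.prod_restrict]
    exact aestronglyMeasurable_diffQuot hg
  have hF₂m : AEStronglyMeasurable F₂ (volume.prod volume) :=
    (hGm.comp_quasiMeasurePreserving Measure.quasiMeasurePreserving_fst).mul
      (aestronglyMeasurable_diffQuot c.continuous.aestronglyMeasurable)
  have hswap : MeasurePreserving (Prod.swap : Space n × Space n → _) (volume.prod volume)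
      (volume.prod volume) := Measure.measurePreserving_swap
  have hF₁n : eLpNorm F₁ (ENNReal.ofReal p) (volume.prod volume) ≤
      M.toNNReal * eLpNorm (diffQuot p θ g) (ENNReal.ofReal p) ((vol A).prod (vol A)) := by
    rw [Measure.prod_restrict, ← eLpNorm_indicator_eq_eLpNorm_restrict (hA.prod hA)]
    refine eLpNorm_le_mul_eLpNorm_of_ae_le_mul (ae_of_all _ fun z => ?_) _
    rw [norm_mul, Real.norm_of_nonneg ((norm_nonneg _).trans (hM 0))]
  have hF₂n : eLpNorm F₂ (ENNReal.ofReal p) (volume.prod volume) ≤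
      K * eLpNorm g (ENNReal.ofReal p) (vol A) := by
    rw [← hGn]
    exact eLpNorm_fst_mul_diffQuot_le hp h0 h1 hC G
  have hpt (z : Space n × Space n) : ‖diffQuot p θ (fun x => c x * g x) z‖ ≤
      ‖(fun z => ‖F₁ z‖ + ‖F₂ z‖ + ‖F₂ z.swap‖) z‖ := by
    rw [Real.norm_of_nonneg (r := (fun z => ‖F₁ z‖ + ‖F₂ z‖ + ‖F₂ z.swap‖) z) (by positivity)]
    obtain ⟨x, y⟩ := z
    have hsw : ‖F₂ (x, y).swap‖ = ‖G y * diffQuot p θ c (x, y)‖ := by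
      simp only [hF₂, diffQuot, Prod.swap_prod_mk, norm_mul, norm_div, norm_sub_rev]
    simp only [hsw]
    by_cases hx : x ∈ A
    · by_cases hy : y ∈ A
      · have e1 : F₁ (x, y) = M * diffQuot p θ g (x, y) := by
          simp only [hF₁]
          rw [indicator_of_mem (show (x, y) ∈ (A : Set (Space n)) ×ˢ (A : Set (Space n)) from
            ⟨hx, hy⟩)]
        have e2 : diffQuot p θ (fun x => c x * g x) (x, y) =
            c x * diffQuot p θ g (x, y) + G y * diffQuot p θ c (x, y) := by
          simp only [diffQuot, hG, indicator_of_mem (show y ∈ (A : Set (Space n)) from hy)]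
          ring
        have e3 : ‖c x * diffQuot p θ g (x, y)‖ ≤ ‖F₁ (x, y)‖ := by
          rw [e1, norm_mul, norm_mul, Real.norm_of_nonneg ((norm_nonneg _).trans (hM 0))]
          gcongr
          exact hM x
        rw [e2]
        refine (norm_add_le _ _).trans ?_
        linarith [norm_nonneg (F₂ (x, y))]
      · have e2 : diffQuot p θ (fun x => c x * g x) (x, y) = F₂ (x, y) := by
          simp only [diffQuot, hF₂, hG, indicator_of_mem (show x ∈ (A : Set (Space n)) from hx),
            hc0 hy]
          ring
        rw [e2]
        linarith [norm_nonneg (F₁ (x, y)), norm_nonneg (G y * diffQuot p θ c (x, y))]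
    · by_cases hy : y ∈ A
      · have e2 : diffQuot p θ (fun x => c x * g x) (x, y) = G y * diffQuot p θ c (x, y) := by
          simp only [diffQuot, hG, indicator_of_mem (show y ∈ (A : Set (Space n)) from hy),
            hc0 hx]
          ring
        rw [e2]
        linarith [norm_nonneg (F₁ (x, y)), norm_nonneg (F₂ (x, y))]
      · have e2 : diffQuot p θ (fun x => c x * g x) (x, y) = 0 := by
          simp [diffQuot, hc0 hx, hc0 hy]
        rw [e2, norm_zero]
        positivity
  calc eLpNorm (diffQuot p θ fun x => c x * g x) (ENNReal.ofReal p) (volume.prod volume)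
      ≤ eLpNorm (fun z => ‖F₁ z‖ + ‖F₂ z‖ + ‖F₂ z.swap‖) (ENNReal.ofReal p)
          (volume.prod volume) := eLpNorm_mono hpt
    _ ≤ eLpNorm F₁ (ENNReal.ofReal p) (volume.prod volume) +
          eLpNorm F₂ (ENNReal.ofReal p) (volume.prod volume) +
          eLpNorm (F₂ ∘ Prod.swap) (ENNReal.ofReal p) (volume.prod volume) := by
        rw [← eLpNorm_norm F₁, ← eLpNorm_norm F₂, ← eLpNorm_norm (F₂ ∘ Prod.swap)]
        refine (eLpNorm_add_le (hF₁m.norm.add hF₂m.norm)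
          (hF₂m.comp_measurePreserving hswap).norm hp1).trans ?_
        gcongr
        exact eLpNorm_add_le hF₁m.norm hF₂m.norm hp1
    _ ≤ M.toNNReal * eLpNorm (diffQuot p θ g) (ENNReal.ofReal p) ((vol A).prod (vol A)) +
          K * eLpNorm g (ENNReal.ofReal p) (vol A) + K * eLpNorm g (ENNReal.ofReal p) (vol A) := by
        rw [eLpNorm_comp_measurePreserving hF₂m hswap]
        gcongr
    _ ≤ _ := by
        rw [ENNReal.coe_add, ENNReal.coe_mul, ENNReal.coe_toNNReal hKt, mul_add, add_assoc,
          ← two_mul, ← mul_assoc]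
        gcongr
        · exact le_self_add
        · exact le_add_self

/-- Integrate the derivative along the segment from `x` to `x + h`, apply Jensen on `(0, 1]`,
exchange the integrals and use translation invariance in `x`. -/
theorem eLpNorm_translate_sub_le {n : ℕ} {p : ℝ} (hp : 1 < p) {f : Space n → ℝ}
    (hf : ContDiff ℝ 1 f) (h : Space n) :
    eLpNorm (fun x => f (x + h) - f x) (ENNReal.ofReal p) volume ≤
      ‖h‖ₑ * eLpNorm (fderiv ℝ f) (ENNReal.ofReal p) volume := by
  have hp0 : 0 < p := by linarith
  have hcf : Continuous (fderiv ℝ f) := hf.continuous_fderiv (by simp)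
  set μ : Measure ℝ := volume.restrict (Ioc 0 1) with hμ
  have hprob : IsProbabilityMeasure μ := ⟨by simp [hμ]⟩
  refine eLpNorm_le_of_lintegral_enorm_rpow_le hp ?_
  have hpt (x : Space n) : ‖f (x + h) - f x‖ₑ ^ p ≤
      ∫⁻ t, ‖h‖ₑ ^ p * ‖fderiv ℝ f (x + t • h)‖ₑ ^ p ∂μ := by
    have hline : Continuous fun t : ℝ => fderiv ℝ f (x + t • h) := by fun_prop
    have hder (t : ℝ) : HasDerivAt (fun t : ℝ => f (x + t • h)) (fderiv ℝ f (x + t • h) h) t := by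
      have h2 : HasDerivAt (fun t : ℝ => x + t • h) h t := by
        simpa using ((hasDerivAt_id t).smul_const h).const_add x
      exact ((hf.differentiable (by simp) _).hasFDerivAt).comp_hasDerivAt t h2
    have hint := intervalIntegral.integral_eq_sub_of_hasDerivAt (a := 0) (b := 1)
      (fun t _ => hder t) ((hline.clm_apply continuous_const).intervalIntegrable _ _)
    simp only [one_smul, zero_smul, add_zero] at hint
    rw [intervalIntegral.integral_of_le zero_le_one] at hint
    have h3 : ‖f (x + h) - f x‖ₑ ≤ ‖h‖ₑ * ∫⁻ t, ‖fderiv ℝ f (x + t • h)‖ₑ ∂μ := by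
      rw [← hint, ← lintegral_const_mul' _ _ enorm_ne_top]
      refine (enorm_integral_le_lintegral_enorm _).trans (lintegral_mono fun t => ?_)
      rw [mul_comm]
      exact ContinuousLinearMap.le_opENorm _ _
    -- Jensen, as monotonicity of the norms in the exponent for a probability measure.
    have h4 := eLpNorm'_le_eLpNorm'_of_exponent_le one_pos hp.le μ
      (hline.aestronglyMeasurable (μ := μ))
    simp only [eLpNorm', ENNReal.rpow_one, div_one] at h4
    calc ‖f (x + h) - f x‖ₑ ^ p
        ≤ (‖h‖ₑ * (∫⁻ t, ‖fderiv ℝ f (x + t • h)‖ₑ ^ p ∂μ) ^ (1 / p)) ^ p := by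
          gcongr
          exact h3.trans (by gcongr)
      _ = _ := by
          rw [ENNReal.mul_rpow_of_nonneg _ _ hp0.le, ← ENNReal.rpow_mul,
            one_div_mul_cancel hp0.ne', ENNReal.rpow_one, lintegral_const_mul' _ _ (by finiteness)]
  calc ∫⁻ x, ‖f (x + h) - f x‖ₑ ^ p
      ≤ ∫⁻ x, ∫⁻ t, ‖h‖ₑ ^ p * ‖fderiv ℝ f (x + t • h)‖ₑ ^ p ∂μ := lintegral_mono hpt
    _ = ∫⁻ t, (∫⁻ x, ‖h‖ₑ ^ p * ‖fderiv ℝ f (x + t • h)‖ₑ ^ p) ∂μ := by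
        refine lintegral_lintegral_swap (Measurable.aemeasurable ?_)
        have : Continuous fun z : Space n × ℝ => fderiv ℝ f (z.1 + z.2 • h) := by fun_prop
        exact (this.measurable.enorm.pow_const p).const_mul _
    _ = ∫⁻ t, ‖h‖ₑ ^ p * (∫⁻ x, ‖fderiv ℝ f x‖ₑ ^ p) ∂μ := by
        refine lintegral_congr fun t => ?_
        rw [lintegral_const_mul' _ _ (by finiteness),
          lintegral_add_right_eq_self (fun x => ‖fderiv ℝ f x‖ₑ ^ p)]
    _ = (‖h‖ₑ * eLpNorm (fderiv ℝ f) (ENNReal.ofReal p) volume) ^ p := by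
        rw [lintegral_const, measure_univ, mul_one, lintegral_enorm_rpow_eq hp,
          ENNReal.mul_rpow_of_nonneg _ _ hp0.le]

/-- The inclusion of `W^{1,p}(ℝⁿ)` in `W^{θ,p}(ℝⁿ)`. With `y = x + h`, the seminorm is a weighted
integral of the norms of `f(· + h) - f`, estimated through the derivative for `‖h‖ ≤ 1` and through
`f` itself for `‖h‖ ≥ 1`. -/
theorem eLpNorm_diffQuot_le {n : ℕ} {p θ : ℝ} (hp : 1 < p) {f : Space n → ℝ}
    (hf : ContDiff ℝ 1 f) :
    eLpNorm (diffQuot p θ f) (ENNReal.ofReal p) (volume.prod volume) ≤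
      eLpNorm (quotKernel (n := n) p θ) (ENNReal.ofReal p) volume *
        (2 * eLpNorm f (ENNReal.ofReal p) volume +
          eLpNorm (fderiv ℝ f) (ENNReal.ofReal p) volume) := by
  have hp0 : 0 < p := by linarith
  set Q := 2 * eLpNorm f (ENNReal.ofReal p) volume +
    eLpNorm (fderiv ℝ f) (ENNReal.ofReal p) volume with hQ
  have hfc : Continuous f := hf.continuous
  have htr (h : Space n) : eLpNorm (fun x => f (x + h) - f x) (ENNReal.ofReal p) volume ≤
      ‖min ‖h‖ 1‖ₑ * Q := by
    rcases le_total ‖h‖ 1 with h1 | h1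
    · rw [min_eq_left h1, enorm_norm]
      exact (eLpNorm_translate_sub_le hp hf h).trans (by gcongr; exact le_add_self)
    · rw [min_eq_right h1, enorm_one, one_mul]
      have hmp : eLpNorm (fun x => f (x + h)) (ENNReal.ofReal p) volume =
          eLpNorm f (ENNReal.ofReal p) volume :=
        eLpNorm_comp_measurePreserving hfc.aestronglyMeasurable (measurePreserving_add_right _ h)
      refine (eLpNorm_sub_le (f := fun x => f (x + h)) (by fun_prop) (by fun_prop)
        (ENNReal.one_le_ofReal.2 hp.le)).trans ?_
      rw [hmp, ← two_mul]
      exact le_self_add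
  refine eLpNorm_le_of_lintegral_enorm_rpow_le hp ?_
  set w : Space n → ℝ≥0∞ := fun h => ‖(‖h‖ ^ (n / p + θ))⁻¹‖ₑ ^ p with hw
  have hwm : Measurable w := by rw [hw]; fun_prop
  calc ∫⁻ z, ‖diffQuot p θ f z‖ₑ ^ p ∂(volume.prod volume)
      ≤ ∫⁻ x, ∫⁻ y, ‖diffQuot p θ f (x, y)‖ₑ ^ p := lintegral_prod_le _
    _ = ∫⁻ x, ∫⁻ h, w h * ‖f (x + h) - f x‖ₑ ^ p := by
        refine lintegral_congr fun x => ?_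
        rw [← lintegral_add_left_eq_self _ x]
        refine lintegral_congr fun h => ?_
        rw [hw, ← ENNReal.mul_rpow_of_nonneg _ _ hp0.le, ← enorm_mul, ← enorm_neg]
        congr 2
        simp only [diffQuot, sub_add_cancel_left, norm_neg]
        ring
    _ = ∫⁻ h, ∫⁻ x, w h * ‖f (x + h) - f x‖ₑ ^ p := by
        refine lintegral_lintegral_swap (Measurable.aemeasurable ?_)
        have : Continuous fun z : Space n × Space n => f (z.1 + z.2) - f z.1 := by fun_prop
        exact (hwm.comp measurable_snd).mul (this.measurable.enorm.pow_const p)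
    _ ≤ ∫⁻ h, ‖quotKernel p θ h‖ₑ ^ p * Q ^ p := by
        refine lintegral_mono fun h => ?_
        have hfh : Measurable fun x => ‖f (x + h) - f x‖ₑ ^ p := by fun_prop
        rw [lintegral_const_mul _ hfh, lintegral_enorm_rpow_eq hp, hw,
          ← ENNReal.mul_rpow_of_nonneg _ _ hp0.le, ← ENNReal.mul_rpow_of_nonneg _ _ hp0.le,
          quotKernel, div_eq_inv_mul (min ‖h‖ 1), enorm_mul, mul_assoc]
        gcongr
        exact htr h
    _ = _ := by
        rw [lintegral_mul_const _ (measurable_quotKernel.enorm.pow_const p),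
          lintegral_enorm_rpow_eq hp, ENNReal.mul_rpow_of_nonneg _ _ hp0.le]

/-! ### Multiplication by test functions -/

theorem Jet.norm_eq {n : ℕ} {Ω : Opens (Space n)} {k : ℕ} {p : ℝ} [Fact (1 < p)] (w : Jet Ω k p) :
    ‖w‖ = ∑ ν, ‖w.fst ν‖ + ∑ ν, ‖w.snd ν‖ := by
  rw [WithLp.prod_norm_eq_of_L1, PiLp.norm_eq_of_L1, PiLp.norm_eq_of_L1]

theorem Jet.norm_fst_le {n : ℕ} {Ω : Opens (Space n)} {k : ℕ} {p : ℝ} [Fact (1 < p)]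
    (w : Jet Ω k p) (ν : MultiIndex n k) : ‖w.fst ν‖ ≤ ‖w‖ :=
  (PiLp.norm_apply_le w.fst ν).trans (WithLp.norm_fst_le _ w)

theorem Jet.norm_snd_le {n : ℕ} {Ω : Opens (Space n)} {k : ℕ} {p : ℝ} [Fact (1 < p)]
    (w : Jet Ω k p) (ν : TopIndex n k) : ‖w.snd ν‖ ≤ ‖w‖ :=
  (PiLp.norm_apply_le w.snd ν).trans (WithLp.norm_snd_le _ w)

/-- The multi-index with entries `β`, if `|β| ≤ k`. -/
def MultiIndex.mk {n k : ℕ} (β : Fin n → ℕ) (h : ∑ i, β i ≤ k) : MultiIndex n k :=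
  ⟨fun i => ⟨β i, Nat.lt_succ_of_le
    ((Finset.single_le_sum (fun _ _ => Nat.zero_le _) (Finset.mem_univ i)).trans h)⟩, h⟩

theorem eLpNorm_partialTest_le {n : ℕ} {Ω : Opens (Space n)} {s p : ℝ} [Fact (1 < p)]
    {β : Fin n → ℕ} (h : ∑ i, β i ≤ ⌊s⌋₊) (ψ : 𝓓(Ω, ℝ)) :
    eLpNorm (partialTest β ψ) (ENNReal.ofReal p) (vol Ω) ≤ ‖testIncl Ω s p ψ‖ₑ := by
  rw [← Lp.enorm_toLp (memLp_test _ _), enorm_le_iff_norm_le]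
  exact Jet.norm_fst_le (testJet Ω s p ψ) (.mk β h)

theorem eLpNorm_diffQuot_partialTest_le {n : ℕ} {Ω : Opens (Space n)} {s p : ℝ} [Fact (1 < p)]
    (hs : Int.fract s ≠ 0) {β : Fin n → ℕ} (h : ∑ i, β i = ⌊s⌋₊) (ψ : 𝓓(Ω, ℝ)) :
    eLpNorm (diffQuot p (Int.fract s) (partialTest β ψ)) (ENNReal.ofReal p)
      ((vol Ω).prod (vol Ω)) ≤ ‖testIncl Ω s p ψ‖ₑ := by
  have hm := Jet.norm_snd_le (testJet Ω s p ψ) ⟨.mk β h.le, h⟩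
  have hval : (testJet Ω s p ψ).snd ⟨.mk β h.le, h⟩ = _ := dif_neg hs
  rw [hval, ← enorm_le_iff_norm_le, Lp.enorm_toLp] at hm
  exact hm

theorem exists_abs_test_le {n : ℕ} {Ω : Opens (Space n)} (c : 𝓓(Ω, ℝ)) :
    ∃ M : ℝ≥0, ∀ x, ‖c x‖ₑ ≤ M := by
  obtain ⟨M, hM⟩ := c.hasCompactSupport.exists_bound_of_continuous c.continuous
  refine ⟨M.toNNReal, fun x => ?_⟩
  rw [← ofReal_norm]
  exact ENNReal.ofReal_le_ofReal (hM x)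

theorem eLpNorm_test_vol {n : ℕ} {Ω : Opens (Space n)} (c : 𝓓(Ω, ℝ)) (q : ℝ≥0∞) :
    eLpNorm c q (vol Ω) = eLpNorm c q volume :=
  eLpNorm_restrict_eq_of_support_subset ((subset_tsupport _).trans c.tsupport_subset)

theorem exists_eLpNorm_diffOp_le {n : ℕ} {Ω : Opens (Space n)} {s p : ℝ} [hp : Fact (1 < p)]
    {m : ℕ} (hm : m ≤ ⌊s⌋₊) {T : 𝓓(Ω, ℝ) →ₗ[ℝ] 𝓓(Ω, ℝ)} (hT : T ∈ diffOp Ω m) :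
    ∃ C : ℝ≥0, ∀ ψ, eLpNorm (T ψ) (ENNReal.ofReal p) volume ≤ C * ‖testIncl Ω s p ψ‖ₑ := by
  induction hT using Submodule.span_induction with
  | mem T hT =>
    obtain ⟨c, β, hβ, rfl⟩ := hT
    obtain ⟨M, hM⟩ := exists_abs_test_le c
    refine ⟨M, fun ψ => ?_⟩
    rw [← eLpNorm_test_vol]
    refine le_trans ?_ (mul_le_mul_right (eLpNorm_partialTest_le (hβ.trans hm) ψ) _)
    refine eLpNorm_le_mul_eLpNorm_of_ae_le_mul' (ae_of_all _ fun x => ?_) _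
    change ‖partialTest β ψ x * c x‖ₑ ≤ _
    rw [enorm_mul, mul_comm]
    gcongr
    exact hM x
  | zero => exact ⟨0, fun ψ => by change eLpNorm (0 : Space n → ℝ) _ _ ≤ _; simp⟩
  | add S T _ _ hS hT =>
    obtain ⟨C, hC⟩ := hS
    obtain ⟨D, hD⟩ := hT
    refine ⟨C + D, fun ψ => ?_⟩
    rw [ENNReal.coe_add, add_mul]
    exact (eLpNorm_add_le (S ψ).aestronglyMeasurable (T ψ).aestronglyMeasurable
      (ENNReal.one_le_ofReal.2 hp.out.le)).trans (add_le_add (hC ψ) (hD ψ))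
  | smul r T _ hT =>
    obtain ⟨C, hC⟩ := hT
    refine ⟨‖r‖₊ * C, fun ψ => ?_⟩
    change eLpNorm (r • ⇑(T ψ)) _ _ ≤ _
    rw [eLpNorm_const_smul, ENNReal.coe_mul, mul_assoc]
    exact mul_le_mul_right (hC ψ) _

theorem diffQuot_add {n : ℕ} (p θ : ℝ) (f g : Space n → ℝ) :
    diffQuot p θ (f + g) = diffQuot p θ f + diffQuot p θ g := by
  funext z
  simp only [diffQuot, Pi.add_apply]
  ring

theorem diffQuot_smul {n : ℕ} (p θ r : ℝ) (f : Space n → ℝ) :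
    diffQuot p θ (r • f) = r • diffQuot p θ f := by
  funext z
  simp only [diffQuot, Pi.smul_apply, smul_eq_mul]
  ring

theorem norm_fderiv_test_le {n : ℕ} {Ω : Opens (Space n)} (f : 𝓓(Ω, ℝ)) (x : Space n) :
    ‖fderiv ℝ f x‖ ≤ ∑ i, ‖(TestFunction.lineDerivCLM ℝ (EuclideanSpace.single i (1 : ℝ)) f :
      𝓓(Ω, ℝ)) x‖ := by
  refine ContinuousLinearMap.opNorm_le_bound _ (Finset.sum_nonneg fun _ _ => norm_nonneg _)
    fun y => ?_
  have hy : y = ∑ i, y i • EuclideanSpace.single i (1 : ℝ) := by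
    ext j
    simp [Finset.sum_apply, Pi.single_apply]
  conv_lhs => rw [hy, map_sum]
  refine (norm_sum_le _ _).trans ?_
  rw [Finset.sum_mul]
  refine Finset.sum_le_sum fun i _ => ?_
  rw [map_smul, norm_smul, lineDeriv_test_apply, mul_comm]
  gcongr
  exact PiLp.norm_apply_le y i

theorem eLpNorm_fderiv_test_le {n : ℕ} {Ω : Opens (Space n)} {q : ℝ≥0∞} (hq : 1 ≤ q)
    (f : 𝓓(Ω, ℝ)) :
    eLpNorm (fderiv ℝ f) q volume ≤ ∑ i, eLpNorm
      (TestFunction.lineDerivCLM ℝ (EuclideanSpace.single i (1 : ℝ)) f : 𝓓(Ω, ℝ)) q volume := by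
  set g : Fin n → 𝓓(Ω, ℝ) := fun i =>
    TestFunction.lineDerivCLM ℝ (EuclideanSpace.single i (1 : ℝ)) f with hg
  calc eLpNorm (fderiv ℝ f) q volume ≤ eLpNorm (∑ i, fun x => ‖g i x‖) q volume := by
        refine eLpNorm_mono fun x => ?_
        rw [Finset.sum_apply, Real.norm_of_nonneg (Finset.sum_nonneg fun _ _ => norm_nonneg _)]
        exact norm_fderiv_test_le f x
    _ ≤ ∑ i, eLpNorm (fun x => ‖g i x‖) q volume :=
        eLpNorm_sum_le (fun i _ => (g i).aestronglyMeasurable.norm) hq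
    _ = _ := Finset.sum_congr rfl fun i _ => eLpNorm_norm _

/-- For a term `c ∂^β ψ` with `|β| = ⌊s⌋`, the norm contains the seminorm of `∂^β ψ` and the product
estimate applies. For `|β| < ⌊s⌋` it does not, but one more derivative is available, and the
inclusion of `W^{1,p}` in `W^{θ,p}` is applied on the whole space. -/
theorem exists_eLpNorm_diffQuot_diffOp_le {n : ℕ} {Ω : Opens (Space n)} {s p : ℝ}
    [hp : Fact (1 < p)] (hs : Int.fract s ≠ 0) {m : ℕ} (hm : m ≤ ⌊s⌋₊)
    {T : 𝓓(Ω, ℝ) →ₗ[ℝ] 𝓓(Ω, ℝ)} (hT : T ∈ diffOp Ω m) :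
    ∃ C : ℝ≥0, ∀ ψ, eLpNorm (diffQuot p (Int.fract s) (T ψ)) (ENNReal.ofReal p)
      (volume.prod volume) ≤ C * ‖testIncl Ω s p ψ‖ₑ := by
  have h0 : 0 < Int.fract s := lt_of_le_of_ne (Int.fract_nonneg s) (Ne.symm hs)
  have h1 := Int.fract_lt_one s
  have hp1 : (1 : ℝ≥0∞) ≤ ENNReal.ofReal p := ENNReal.one_le_ofReal.2 hp.out.le
  have hmeas (f : 𝓓(Ω, ℝ)) :
      AEStronglyMeasurable (diffQuot p (Int.fract s) f) (volume.prod volume) :=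
    aestronglyMeasurable_diffQuot f.aestronglyMeasurable
  induction hT using Submodule.span_induction with
  | mem T hT =>
    obtain ⟨c, β, hβ, rfl⟩ := hT
    rcases (hβ.trans hm).eq_or_lt with hk | hk
    · obtain ⟨C, hC⟩ := eLpNorm_diffQuot_mul_le hp.out h0 h1 c
      refine ⟨C * 2, fun ψ => ?_⟩
      have hfun : ⇑(mulTest c (partialTest β ψ)) = fun x => c x * partialTest β ψ x :=
        funext fun x => mul_comm _ _
      change eLpNorm (diffQuot p (Int.fract s) ⇑(mulTest c (partialTest β ψ))) _ _ ≤ _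
      rw [hfun]
      refine (hC _ (partialTest β ψ).aestronglyMeasurable).trans ?_
      rw [ENNReal.coe_mul, mul_assoc, ENNReal.coe_two, two_mul]
      gcongr
      · exact eLpNorm_diffQuot_partialTest_le hs hk ψ
      · exact eLpNorm_partialTest_le hk.le ψ
    · set T : 𝓓(Ω, ℝ) →ₗ[ℝ] 𝓓(Ω, ℝ) := ((mulTest c ∘L partialTest β : 𝓓(Ω, ℝ) →L[ℝ] 𝓓(Ω, ℝ)) : 𝓓(Ω, ℝ) →ₗ[ℝ] 𝓓(Ω, ℝ))
        with hTdef
      -- The exact order `|β|` replaces the bound `m`, so that `∂ᵢ T` still has order at most `⌊s⌋`.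
      have hT : T ∈ diffOp Ω (∑ i, β i) := Submodule.subset_span ⟨c, β, le_rfl, rfl⟩
      obtain ⟨C, hC⟩ := exists_eLpNorm_diffOp_le (p := p) hk.le hT
      have hD (i : Fin n) := exists_eLpNorm_diffOp_le (p := p) hk (lineDeriv_comp_mem_diffOp i hT)
      choose D hD using hD
      have hK := (eLpNorm_quotKernel_lt_top (n := n) hp.out h0 h1).ne
      refine ⟨(eLpNorm (quotKernel (n := n) p (Int.fract s)) (ENNReal.ofReal p) volume).toNNReal *
        (2 * C + ∑ i, D i), fun ψ => ?_⟩
      refine (eLpNorm_diffQuot_le hp.out ((T ψ).contDiff.of_le (mod_cast le_top))).trans ?_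
      rw [ENNReal.coe_mul, ENNReal.coe_toNNReal hK, mul_assoc]
      gcongr
      rw [ENNReal.coe_add, ENNReal.coe_mul, ENNReal.coe_two, add_mul, mul_assoc,
        ENNReal.ofNNReal_finsetSum, Finset.sum_mul]
      gcongr
      · exact hC ψ
      · exact (eLpNorm_fderiv_test_le hp1 _).trans (Finset.sum_le_sum fun i _ => hD i ψ)
  | zero =>
    refine ⟨0, fun ψ => ?_⟩
    have : diffQuot p (Int.fract s) ((0 : 𝓓(Ω, ℝ) →ₗ[ℝ] 𝓓(Ω, ℝ)) ψ) = 0 := by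
      funext z
      change ((0 : ℝ) - 0) / _ = 0
      simp
    rw [this]
    simp
  | add S T _ _ hS hT =>
    obtain ⟨C, hC⟩ := hS
    obtain ⟨D, hD⟩ := hT
    refine ⟨C + D, fun ψ => ?_⟩
    rw [ENNReal.coe_add, add_mul]
    change eLpNorm (diffQuot p (Int.fract s) (⇑(S ψ) + ⇑(T ψ))) _ _ ≤ _
    rw [diffQuot_add]
    exact (eLpNorm_add_le (hmeas _) (hmeas _) hp1).trans (add_le_add (hC ψ) (hD ψ))
  | smul r T _ hT =>
    obtain ⟨C, hC⟩ := hT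
    refine ⟨‖r‖₊ * C, fun ψ => ?_⟩
    change eLpNorm (diffQuot p (Int.fract s) (r • ⇑(T ψ))) _ _ ≤ _
    rw [diffQuot_smul, eLpNorm_const_smul]
    exact (mul_le_mul_right (hC ψ) ‖r‖ₑ).trans_eq (mul_assoc ‖r‖ₑ (C : ℝ≥0∞) _).symm

/-- Multiplication by a test function on `A` is bounded from `W^{s,p}(A)` to `W^{s,p}(B)`, for
test functions whose product lies in `C_c^∞(B)`. For `B = A` this is the multiplication property of
`W^{s,p}_0(A)`, which therefore holds for every open set `A`. -/
theorem exists_norm_testIncl_mul_le {n : ℕ} {A : Opens (Space n)} (s p : ℝ) [hp : Fact (1 < p)]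
    (c : 𝓓(A, ℝ)) :
    ∃ C : ℝ, 0 ≤ C ∧ ∀ (B : Opens (Space n)) (f : 𝓓(B, ℝ)) (ψ : 𝓓(A, ℝ)),
      (∀ x, f x = ψ x * c x) → ‖testIncl B s p f‖ ≤ C * ‖testIncl A s p ψ‖ := by
  have hfst (ν : MultiIndex n ⌊s⌋₊) := exists_eLpNorm_diffOp_le (p := p) ν.2
    (partialTest_comp_mulTest_mem_diffOp ν.toNat c)
  choose C hC using hfst
  have hsnd (ν : TopIndex n ⌊s⌋₊) : ∃ D : ℝ≥0, Int.fract s ≠ 0 → ∀ ψ,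
      eLpNorm (diffQuot p (Int.fract s) (partialTest ν.1.toNat (mulTest c ψ)))
        (ENNReal.ofReal p) (volume.prod volume) ≤ D * ‖testIncl A s p ψ‖ₑ := by
    by_cases hs : Int.fract s = 0
    · exact ⟨0, fun h => (h hs).elim⟩
    · obtain ⟨D, hD⟩ := exists_eLpNorm_diffQuot_diffOp_le (p := p) hs ν.1.2
        (partialTest_comp_mulTest_mem_diffOp ν.1.toNat c)
      exact ⟨D, fun _ => hD⟩
  choose D hD using hsnd
  refine ⟨∑ ν, (C ν : ℝ) + ∑ ν, (D ν : ℝ), by positivity, fun B f ψ hf => ?_⟩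
  -- The same function is viewed on `B` and on `A`. The estimates hold over the whole space, so no
  -- relation between `A` and `B` is required.
  have hcoe : (f : Space n → ℝ) = mulTest c ψ := funext hf
  have henorm {E : ℝ≥0} {G H : Type _} [NormedAddCommGroup G] [NormedAddCommGroup H] {x : G}
      {y : H} (h : ‖x‖ₑ ≤ E * ‖y‖ₑ) : ‖x‖ ≤ E * ‖y‖ := by
    rw [enorm_eq_nnnorm, enorm_eq_nnnorm, ← ENNReal.coe_mul, ENNReal.coe_le_coe] at h
    exact h
  change ‖testJet B s p f‖ ≤ _
  rw [Jet.norm_eq, add_mul, Finset.sum_mul, Finset.sum_mul]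
  refine add_le_add (Finset.sum_le_sum fun ν _ => henorm ?_)
    (Finset.sum_le_sum fun ν _ => henorm ?_)
  · change ‖(memLp_test (ENNReal.ofReal p) (partialTest ν.toNat f)).toLp _‖ₑ ≤ _
    rw [Lp.enorm_toLp, eLpNorm_test_vol, partialTest_congr ν.toNat hcoe]
    exact hC ν ψ
  · by_cases hs : Int.fract s = 0
    · have hval : (testJet B s p f).snd ν = _ := dif_pos hs
      rw [hval, enorm_zero]
      exact zero_le
    · have hval : (testJet B s p f).snd ν = _ := dif_neg hs
      rw [hval, Lp.enorm_toLp, partialTest_congr ν.1.toNat hcoe, Measure.prod_restrict]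
      exact (eLpNorm_restrict_le _ _ _ _).trans (hD ν hs ψ)

/-! ### Restriction and extension by zero, nonnegative order -/

theorem lpToDistr_toLp_apply {n : ℕ} {Ω : Opens (Space n)} {p : ℝ} [Fact (1 < p)]
    {f : Space n → ℝ} (hf : MemLp f (ENNReal.ofReal p) (vol Ω)) (φ : 𝓓(Ω, ℝ)) :
    lpToDistr Ω p (hf.toLp f) φ = ∫ x in (Ω : Set (Space n)), φ x * f x := by
  change ofFun Ω _ φ = _
  rw [ofFun_apply (locallyIntegrableOn_lp _)]
  refine integral_congr_ae ?_
  filter_upwards [hf.coeFn_toLp] with x hx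
  rw [hx]

theorem lpToDistr_apply {n : ℕ} {Ω : Opens (Space n)} {p : ℝ} [Fact (1 < p)]
    (f : Lp ℝ (ENNReal.ofReal p) (vol Ω)) (φ : 𝓓(Ω, ℝ)) :
    lpToDistr Ω p f φ = ∫ x in (Ω : Set (Space n)), φ x * f x :=
  ofFun_apply (locallyIntegrableOn_lp f) φ

/-- An element of `W^{s,p}(Ω)` with prescribed derivatives. -/
theorem exists_sobolevNonneg {n : ℕ} {Ω : Opens (Space n)} {s p : ℝ} [Fact (1 < p)]
    {e : MultiIndex n ⌊s⌋₊ → Space n → ℝ} (he : ∀ ν, MemLp (e ν) (ENNReal.ofReal p) (vol Ω))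
    (hd : ∀ ν, lpToDistr Ω p ((he ν).toLp _) =
      partialDistr ν.toNat (lpToDistr Ω p ((he (.zero n _)).toLp _)))
    (hq : Int.fract s ≠ 0 → ∀ ν : TopIndex n ⌊s⌋₊, AEStronglyMeasurable
      (diffQuot p (Int.fract s) (e ν.1)) ((vol Ω).prod (vol Ω)))
    {a : MultiIndex n ⌊s⌋₊ → ℝ} {b : TopIndex n ⌊s⌋₊ → ℝ} (hb0 : ∀ ν, 0 ≤ b ν)
    (ha0 : ∀ ν, 0 ≤ a ν)
    (ha : ∀ ν, eLpNorm (e ν) (ENNReal.ofReal p) (vol Ω) ≤ ENNReal.ofReal (a ν))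
    (hb : Int.fract s ≠ 0 → ∀ ν, eLpNorm (diffQuot p (Int.fract s) (e ν.1)) (ENNReal.ofReal p)
      ((vol Ω).prod (vol Ω)) ≤ ENNReal.ofReal (b ν)) :
    ∃ w : SobolevNonneg Ω s p, SobolevNonneg.toDistr Ω s p w =
      lpToDistr Ω p ((he (.zero n _)).toLp _) ∧ ‖w‖ ≤ ∑ ν, a ν + ∑ ν, b ν := by
  classical
  have hmem (h : Int.fract s ≠ 0) (ν : TopIndex n ⌊s⌋₊) : MemLp
      (diffQuot p (Int.fract s) (e ν.1)) (ENNReal.ofReal p) ((vol Ω).prod (vol Ω)) :=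
    ⟨hq h ν, (hb h ν).trans_lt ENNReal.ofReal_lt_top⟩
  set J : Jet Ω ⌊s⌋₊ p := WithLp.toLp 1 (WithLp.toLp 1 fun ν => (he ν).toLp _,
    WithLp.toLp 1 fun ν => if h : Int.fract s = 0 then 0 else (hmem h ν).toLp _) with hJ
  have hfst (ν) : J.fst ν = (he ν).toLp _ := rfl
  have hsnd (ν) : J.snd ν = if h : Int.fract s = 0 then 0 else (hmem h ν).toLp _ := rfl
  refine ⟨⟨J, fun ν => hd ν, fun ν => ⟨fun h => ?_, fun h => ?_⟩⟩, rfl, ?_⟩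
  · rw [hsnd, dif_pos h]
  · rw [hsnd, dif_neg h, hfst]
    refine (MemLp.coeFn_toLp _).trans ?_
    filter_upwards [Measure.quasiMeasurePreserving_fst.ae (he ν.1).coeFn_toLp,
      Measure.quasiMeasurePreserving_snd.ae (he ν.1).coeFn_toLp] with z h1 h2
    rw [diffQuot, diffQuot, h1, h2]
  · change ‖J‖ ≤ _
    rw [Jet.norm_eq]
    refine add_le_add (Finset.sum_le_sum fun ν _ => ?_) (Finset.sum_le_sum fun ν _ => ?_)
    · rw [hfst, Lp.norm_toLp]
      exact ENNReal.toReal_le_of_le_ofReal (ha0 ν) (ha ν)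
    · rw [hsnd]
      split_ifs with h
      · rw [norm_zero]
        exact hb0 ν
      · rw [Lp.norm_toLp]
        exact ENNReal.toReal_le_of_le_ofReal (hb0 ν) (hb h ν)

theorem eLpNorm_lp_eq {α : Type*} [MeasurableSpace α] {μ : Measure α} {q : ℝ≥0∞} (f : Lp ℝ q μ) :
    eLpNorm f q μ = ENNReal.ofReal ‖f‖ := by
  rw [Lp.norm_def, ENNReal.ofReal_toReal (Lp.eLpNorm_ne_top f)]

/-- Derivatives and difference quotients restrict, and only the domain of integration shrinks. -/
theorem exists_restrict_nonneg {n : ℕ} {U Ω : Opens (Space n)} (hU : U ≤ Ω) {s p : ℝ}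
    [Fact (1 < p)] (w : SobolevNonneg Ω s p) :
    ∃ w' : SobolevNonneg U s p, SobolevNonneg.toDistr U s p w' =
      resDistr U Ω (SobolevNonneg.toDistr Ω s p w) ∧ ‖w'‖ ≤ ‖w‖ := by
  have hle : vol U ≤ vol Ω := Measure.restrict_mono hU le_rfl
  have hle2 : (vol U).prod (vol U) ≤ (vol Ω).prod (vol Ω) := by
    rw [Measure.prod_restrict, Measure.prod_restrict]
    exact Measure.restrict_mono (prod_mono hU hU) le_rfl
  have he (ν) : MemLp (w.1.fst ν) (ENNReal.ofReal p) (vol U) := (Lp.memLp _).mono_measure hle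
  have hres (ν) : lpToDistr U p ((he ν).toLp _) = resDistr U Ω (lpToDistr Ω p (w.1.fst ν)) := by
    ext ψ
    rw [lpToDistr_toLp_apply, resDistr_apply, lpToDistr_apply, coe_inclTest hU]
    refine (setIntegral_eq_of_subset_of_forall_sdiff_eq_zero Ω.isOpen.measurableSet hU
      fun x hx => ?_).symm
    rw [image_eq_zero_of_notMem_tsupport (fun h => hx.2 (ψ.tsupport_subset h)), zero_mul]
  obtain ⟨w', h1, h2⟩ := exists_sobolevNonneg (s := s) he
    (fun ν => by rw [hres, hres, w.2.1 ν, resDistr_partialDistr hU])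
    (fun h ν => ((Lp.aestronglyMeasurable _).congr ((w.2.2 ν).2 h)).mono_measure hle2)
    (a := fun ν => ‖w.1.fst ν‖) (b := fun ν => ‖w.1.snd ν‖)
    (fun _ => norm_nonneg _) (fun _ => norm_nonneg _)
    (fun ν => (eLpNorm_mono_measure _ hle).trans_eq (eLpNorm_lp_eq _))
    (fun h ν => (eLpNorm_mono_measure _ hle2).trans_eq
      ((eLpNorm_congr_ae ((w.2.2 ν).2 h).symm).trans (eLpNorm_lp_eq _)))
  refine ⟨w', h1.trans (hres _), h2.trans_eq ?_⟩
  exact (Jet.norm_eq w.1).symm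

/-- By `VanishesOff.partialDistr` the derivatives of the extension are `χ ∂^ν u`. Each is bounded in
`L^p`, and at top order `eLpNorm_diffQuot_mul_le` applies with quantities that the norm on `U`
contains. -/
theorem exists_extend_nonneg {n : ℕ} {U : Opens (Space n)} (Ω : Opens (Space n)) (hU : U ≤ Ω)
    (s p : ℝ) [hp : Fact (1 < p)] {K : Set (Space n)} {χ : 𝓓(U, ℝ)}
    (hχ : ∀ x ∈ K, χ =ᶠ[𝓝 x] 1) :
    ∃ C : ℝ, ∀ w : SobolevNonneg U s p, VanishesOff K (SobolevNonneg.toDistr U s p w) →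
      ∃ w' : SobolevNonneg Ω s p, SobolevNonneg.toDistr Ω s p w' =
        extDistr Ω χ (SobolevNonneg.toDistr U s p w) ∧ ‖w'‖ ≤ C * ‖w‖ := by
  obtain ⟨M, hM⟩ := exists_abs_test_le χ
  have hq : ∃ D : ℝ≥0, Int.fract s ≠ 0 → ∀ g : Space n → ℝ, AEStronglyMeasurable g (vol U) →
      eLpNorm (diffQuot p (Int.fract s) fun x => χ x * g x) (ENNReal.ofReal p)
        (volume.prod volume) ≤ D * (eLpNorm (diffQuot p (Int.fract s) g) (ENNReal.ofReal p)
          ((vol U).prod (vol U)) + eLpNorm g (ENNReal.ofReal p) (vol U)) := by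
    by_cases hs : Int.fract s = 0
    · exact ⟨0, fun h => (h hs).elim⟩
    · obtain ⟨D, hD⟩ := eLpNorm_diffQuot_mul_le hp.out
        (lt_of_le_of_ne (Int.fract_nonneg s) (Ne.symm hs)) (Int.fract_lt_one s) χ
      exact ⟨D, fun _ => hD⟩
  obtain ⟨D, hD⟩ := hq
  -- The factor two: the product estimate involves a seminorm and an `L^p` norm, each at most `‖w‖`.
  refine ⟨∑ _ : MultiIndex n ⌊s⌋₊, (M : ℝ) + ∑ _ : TopIndex n ⌊s⌋₊, (2 * D : ℝ),
    fun w hw => ?_⟩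
  -- The representative of `w.1.fst ν` is arbitrary outside `U`; the factor `χ` makes the product
  -- vanish there.
  set e : MultiIndex n ⌊s⌋₊ → Space n → ℝ := fun ν x => χ x * w.1.fst ν x with he_def
  have hχ0 {x : Space n} (hx : x ∉ U) : χ x = 0 :=
    image_eq_zero_of_notMem_tsupport fun h => hx (χ.tsupport_subset h)
  have hsupp (ν) : Function.support (e ν) ⊆ U := fun x hx => by
    by_contra h
    exact hx (by simp [he_def, hχ0 h])
  have hem (ν) : AEStronglyMeasurable (e ν) volume := by
    have h1 : AEStronglyMeasurable (e ν) (vol U) :=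
      χ.aestronglyMeasurable.mul (Lp.aestronglyMeasurable _)
    have h2 : (U : Set (Space n)).indicator (e ν) = e ν := indicator_eq_self.2 (hsupp ν)
    rw [← h2]
    exact (aestronglyMeasurable_indicator_iff U.isOpen.measurableSet).2 h1
  have hen (ν) : eLpNorm (e ν) (ENNReal.ofReal p) (vol Ω) ≤ ENNReal.ofReal (M * ‖w‖) := by
    refine (eLpNorm_restrict_le _ _ _ _).trans ?_
    rw [← eLpNorm_restrict_eq_of_support_subset (hsupp ν)]
    refine (eLpNorm_le_mul_eLpNorm_of_ae_le_mul' (g := w.1.fst ν) (c := M)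
      (ae_of_all _ fun x => ?_) _).trans ?_
    · rw [enorm_mul]
      gcongr
      exact hM x
    · rw [eLpNorm_lp_eq, ENNReal.ofReal_mul M.coe_nonneg, ENNReal.ofReal_coe_nnreal]
      gcongr
      exact Jet.norm_fst_le w.1 ν
  have he (ν) : MemLp (e ν) (ENNReal.ofReal p) (vol Ω) :=
    ⟨(hem ν).restrict, (hen ν).trans_lt ENNReal.ofReal_lt_top⟩
  have hext (ν) : lpToDistr Ω p ((he ν).toLp _) = extDistr Ω χ (lpToDistr U p (w.1.fst ν)) := by
    ext ψ
    rw [lpToDistr_toLp_apply, extDistr_apply, lpToDistr_apply]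
    refine (setIntegral_eq_of_subset_of_forall_sdiff_eq_zero Ω.isOpen.measurableSet hU
      fun x hx => ?_).trans (integral_congr_ae (ae_of_all _ fun x => ?_))
    · simp [he_def, hχ0 hx.2]
    · simp only [he_def, cutTest_apply, mul_assoc]
  obtain ⟨w', h1, h2⟩ := exists_sobolevNonneg (s := s) he
    (fun ν => by
      rw [hext, hext, w.2.1 ν]
      exact (VanishesOff.partialDistr hχ hw ν.toNat).2)
    (fun _ ν => aestronglyMeasurable_diffQuot (hem ν.1).restrict)
    (a := fun _ => M * ‖w‖) (b := fun _ => 2 * D * ‖w‖)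
    (fun _ => by positivity) (fun _ => by positivity) hen
    (fun h ν => by
      rw [Measure.prod_restrict]
      refine (eLpNorm_restrict_le _ _ _ _).trans ((hD h _ (Lp.aestronglyMeasurable _)).trans ?_)
      rw [← eLpNorm_congr_ae ((w.2.2 ν).2 h), eLpNorm_lp_eq, eLpNorm_lp_eq,
        ← ENNReal.ofReal_add (norm_nonneg _) (norm_nonneg _), mul_assoc, mul_left_comm,
        ENNReal.ofReal_mul D.coe_nonneg, ENNReal.ofReal_coe_nnreal, two_mul]
      gcongr
      · exact Jet.norm_snd_le w.1 ν
      · exact Jet.norm_fst_le w.1 ν.1)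
  refine ⟨w', h1.trans (hext _), h2.trans_eq ?_⟩
  rw [add_mul, Finset.sum_mul, Finset.sum_mul]

/-- Hölder's inequality, with `ψ` in the conjugate Lebesgue space. -/
theorem exists_abs_toDistr_nonneg_le {n : ℕ} {Ω : Opens (Space n)} (s p : ℝ) [hp : Fact (1 < p)]
    (ψ : 𝓓(Ω, ℝ)) :
    ∃ C : ℝ, ∀ w : SobolevNonneg Ω s p, |SobolevNonneg.toDistr Ω s p w ψ| ≤ C * ‖w‖ := by
  have : ENNReal.HolderConjugate (ENNReal.ofReal p.conjExponent) (ENNReal.ofReal p) :=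
    (Real.HolderConjugate.conjExponent hp.out).symm.ennrealOfReal
  set Λ := (ContinuousLinearMap.mul ℝ ℝ).lpPairing (vol Ω) (ENNReal.ofReal p.conjExponent)
    (ENNReal.ofReal p) ((memLp_test _ ψ).toLp ψ) with hΛ
  refine ⟨‖Λ‖, fun w => ?_⟩
  have hpair : SobolevNonneg.toDistr Ω s p w ψ = Λ (w.1.fst (.zero n _)) := by
    rw [hΛ, ContinuousLinearMap.lpPairing_eq_integral]
    refine (lpToDistr_apply _ ψ).trans (integral_congr_ae ?_)
    filter_upwards [(memLp_test (ENNReal.ofReal p.conjExponent) ψ).coeFn_toLp] with x hx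
    rw [hx]
    rfl
  rw [hpair, ← Real.norm_eq_abs]
  exact (Λ.le_opNorm _).trans (mul_le_mul_of_nonneg_left (Jet.norm_fst_le w.1 _) (norm_nonneg _))

/-! ### Negative order -/

theorem denseRange_testInclZero {n : ℕ} (Ω : Opens (Space n)) (s p : ℝ) [Fact (1 < p)] :
    DenseRange (testInclZero Ω s p) := by
  rintro ⟨w, hw⟩
  rw [closure_subtype]
  refine closure_mono ?_ hw
  rintro _ ⟨φ, rfl⟩
  exact ⟨testInclZero Ω s p φ, ⟨φ, rfl⟩, rfl⟩

theorem exists_extension_of_bound {E X : Type*} [AddCommGroup E] [Module ℝ E]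
    [NormedAddCommGroup X] [NormedSpace ℝ X] {e : E →ₗ[ℝ] X} (he : DenseRange e)
    (f : E →ₗ[ℝ] ℝ) {C : ℝ} (hC : 0 ≤ C) (h : ∀ x, ‖f x‖ ≤ C * ‖e x‖) :
    ∃ F : StrongDual ℝ X, (∀ x, F (e x) = f x) ∧ ‖F‖ ≤ C :=
  ⟨f.extendOfNorm e, fun x => LinearMap.extendOfNorm_eq he ⟨C, h⟩ x,
    ContinuousLinearMap.opNorm_le_bound _ hC
      fun x => LinearMap.norm_extendOfNorm_apply_le he C h x⟩

/-- A bound on test functions suffices for membership in a space of negative order, as these are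
dense in `W^{-s,p'}_0`. -/
theorem exists_dual_of_bound {n : ℕ} {Ω : Opens (Space n)} {s p : ℝ} [Fact (1 < p)]
    (u : 𝓓'(Ω, ℝ)) {C : ℝ} (hC : 0 ≤ C)
    (h : ∀ ψ, |u ψ| ≤ C * ‖testIncl Ω (-s) p.conjExponent ψ‖) :
    ∃ F : SobolevDual Ω s p, (F, u) ∈ dualGraph Ω s p ∧ ‖F‖ ≤ C :=
  @exists_extension_of_bound 𝓓(Ω, ℝ) (SobolevZero Ω (-s) p.conjExponent) inferInstance inferInstance
    inferInstance inferInstance (testInclZero Ω (-s) p.conjExponent)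
    (denseRange_testInclZero Ω (-s) p.conjExponent) (u : 𝓓(Ω, ℝ) →ₗ[ℝ] ℝ) C hC h

/-! ### Sobolev spaces of real order as spaces of distributions -/

namespace Sobolev

theorem toDistr_injective {n : ℕ} {Ω : Opens (Space n)} {s p : ℝ} [Fact (1 < p)] :
    Function.Injective (toDistr : Sobolev Ω s p →ₗ[ℝ] 𝓓'(Ω, ℝ)) :=
  Subtype.val_injective

theorem exists_toDistr_eq {n : ℕ} {Ω : Opens (Space n)} {s p : ℝ} [Fact (1 < p)] {X : Type}
    [NormedAddCommGroup X] [NormedSpace ℝ X] {R : DistrRel X Ω}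
    (h1 : ∀ x, (x, 0) ∈ R → x = 0)
    (h3 : ∀ u, sobolevNorm Ω s p u = graphNorm R u)
    (h4 : sobolevSubmodule Ω s p = R.map (LinearMap.snd ℝ _ _)) {x : X} {u : 𝓓'(Ω, ℝ)}
    (h : (x, u) ∈ R) : ∃ f : Sobolev Ω s p, f.toDistr = u ∧ ‖f‖ = ‖x‖ := by
  have hu : u ∈ sobolevSubmodule Ω s p := by
    rw [h4]
    exact ⟨(x, u), h, rfl⟩
  exact ⟨(⟨u, hu⟩ : sobolevSubmodule Ω s p), rfl, (h3 u).trans (graphNorm_eq h1 h)⟩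

theorem exists_mem_rel {n : ℕ} {Ω : Opens (Space n)} {s p : ℝ} [Fact (1 < p)] {X : Type}
    [NormedAddCommGroup X] [NormedSpace ℝ X] {R : DistrRel X Ω}
    (h1 : ∀ x, (x, 0) ∈ R → x = 0)
    (h3 : ∀ u, sobolevNorm Ω s p u = graphNorm R u)
    (h4 : sobolevSubmodule Ω s p = R.map (LinearMap.snd ℝ _ _)) (f : Sobolev Ω s p) :
    ∃ x : X, (x, f.toDistr) ∈ R ∧ ‖x‖ = ‖f‖ := by
  have hu : toDistr f ∈ sobolevSubmodule Ω s p := f.2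
  rw [h4] at hu
  obtain ⟨w, hw, hwu⟩ := hu
  have hw' : (w.1, f.toDistr) ∈ R := by rw [← hwu]; exact hw
  exact ⟨w.1, hw', ((h3 _).trans (graphNorm_eq h1 hw')).symm⟩

theorem exists_toDistr_eq_nonneg {n : ℕ} {Ω : Opens (Space n)} {s p : ℝ} [Fact (1 < p)]
    (hs : 0 ≤ s) (w : SobolevNonneg Ω s p) :
    ∃ f : Sobolev Ω s p, f.toDistr = SobolevNonneg.toDistr Ω s p w ∧ ‖f‖ = ‖w‖ :=
  exists_toDistr_eq (nonnegGraph_inj Ω s p) (fun _ => if_pos hs) (if_pos hs)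
    ((LinearMap.mem_graph_iff _ (x := (w, _))).2 rfl)

theorem exists_nonneg_toDistr_eq {n : ℕ} {Ω : Opens (Space n)} {s p : ℝ} [Fact (1 < p)]
    (hs : 0 ≤ s) (f : Sobolev Ω s p) :
    ∃ w : SobolevNonneg Ω s p, SobolevNonneg.toDistr Ω s p w = f.toDistr ∧ ‖w‖ = ‖f‖ := by
  obtain ⟨w, hw, hn⟩ := exists_mem_rel (nonnegGraph_inj Ω s p) (fun _ => if_pos hs) (if_pos hs) f
  exact ⟨w, ((LinearMap.mem_graph_iff _ _).1 hw).symm, hn⟩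

theorem exists_toDistr_eq_dual {n : ℕ} {Ω : Opens (Space n)} {s p : ℝ} [Fact (1 < p)]
    (hs : ¬0 ≤ s) {F : SobolevDual Ω s p} {u : 𝓓'(Ω, ℝ)} (h : (F, u) ∈ dualGraph Ω s p) :
    ∃ f : Sobolev Ω s p, f.toDistr = u ∧ ‖f‖ = ‖F‖ :=
  exists_toDistr_eq (dualGraph_inj Ω s p) (fun _ => if_neg hs) (if_neg hs) h

theorem norm_strongDual_apply_le {X : Type*} [NormedAddCommGroup X] [NormedSpace ℝ X]
    (F : StrongDual ℝ X) (x : X) : ‖F x‖ ≤ ‖F‖ * ‖x‖ :=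
  F.le_opNorm x

theorem abs_toDistr_le_of_neg {n : ℕ} {Ω : Opens (Space n)} {s p : ℝ} [Fact (1 < p)]
    (hs : ¬0 ≤ s) (f : Sobolev Ω s p) (ψ : 𝓓(Ω, ℝ)) :
    |f.toDistr ψ| ≤ ‖f‖ * ‖testIncl Ω (-s) p.conjExponent ψ‖ := by
  obtain ⟨F, hF, hn⟩ := exists_mem_rel (dualGraph_inj Ω s p) (fun _ => if_neg hs) (if_neg hs) f
  rw [← hn, ← hF ψ]
  exact @norm_strongDual_apply_le (SobolevZero Ω (-s) p.conjExponent) inferInstance inferInstance F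
    (testInclZero Ω (-s) p.conjExponent ψ)

theorem exists_abs_toDistr_le {n : ℕ} {Ω : Opens (Space n)} (s p : ℝ) [Fact (1 < p)]
    (ψ : 𝓓(Ω, ℝ)) : ∃ C : ℝ, ∀ f : Sobolev Ω s p, |f.toDistr ψ| ≤ C * ‖f‖ := by
  by_cases hs : 0 ≤ s
  · obtain ⟨C, hC⟩ := exists_abs_toDistr_nonneg_le s p ψ
    refine ⟨C, fun f => ?_⟩
    obtain ⟨w, hw, hn⟩ := exists_nonneg_toDistr_eq hs f
    rw [← hw, ← hn]
    exact hC w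
  · refine ⟨‖testIncl Ω (-s) p.conjExponent ψ‖, fun f => ?_⟩
    rw [mul_comm]
    exact abs_toDistr_le_of_neg hs f ψ

/-- Norm convergence implies convergence as distributions; this identifies all limits below. -/
theorem continuous_toDistr_apply {n : ℕ} {Ω : Opens (Space n)} {s p : ℝ} [Fact (1 < p)]
    (ψ : 𝓓(Ω, ℝ)) : Continuous fun f : Sobolev Ω s p => f.toDistr ψ := by
  obtain ⟨C, hC⟩ := exists_abs_toDistr_le s p ψ
  exact (LinearMap.mkContinuous
    (⟨⟨fun f : Sobolev Ω s p => f.toDistr ψ,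
      fun f g => congrArg (fun u : 𝓓'(Ω, ℝ) => u ψ) (map_add toDistr f g)⟩,
      fun c f => congrArg (fun u : 𝓓'(Ω, ℝ) => u ψ) (map_smul toDistr c f)⟩ :
        Sobolev Ω s p →ₗ[ℝ] ℝ) C hC).continuous

/-- Elements of `W^{s,p}(Ω)` supported in a compact subset of `U` restrict to `W^{s,p}(U)`, with a
bound. -/
theorem exists_restrict {n : ℕ} {U Ω : Opens (Space n)} (hU : U ≤ Ω) (s p : ℝ) [Fact (1 < p)]
    (χ : 𝓓(U, ℝ)) :
    ∃ C : ℝ, ∀ f : Sobolev Ω s p,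
      (∀ ψ : 𝓓(Ω, ℝ), f.toDistr ψ = f.toDistr (inclTest U Ω (cutTest Ω χ ψ))) →
      ∃ f' : Sobolev U s p, f'.toDistr = resDistr U Ω f.toDistr ∧ ‖f'‖ ≤ C * ‖f‖ := by
  by_cases hs : 0 ≤ s
  · refine ⟨1, fun f _ => ?_⟩
    obtain ⟨w, hw, hn⟩ := exists_nonneg_toDistr_eq hs f
    obtain ⟨w', hw', hn'⟩ := exists_restrict_nonneg hU w
    obtain ⟨f', hf', hnf'⟩ := exists_toDistr_eq_nonneg hs w'
    refine ⟨f', by rw [hf', hw', hw], ?_⟩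
    rw [hnf', ← hn, one_mul]
    exact hn'
  -- By duality, test functions on `U` have to be bounded in the norm on `Ω`. By `hf` they may first
  -- be multiplied by `χ`, which keeps their supports in a fixed compact subset of `U`.
  · obtain ⟨C, hC0, hC⟩ := exists_norm_testIncl_mul_le (-s) p.conjExponent χ
    refine ⟨C, fun f hf => ?_⟩
    obtain ⟨F, hF, hn⟩ := exists_dual_of_bound (s := s) (p := p) (resDistr U Ω f.toDistr)
      (C := C * ‖f‖) (by positivity) fun ψ => by
        rw [resDistr_apply, hf, mul_comm C, mul_assoc]
        refine (abs_toDistr_le_of_neg hs f _).trans (mul_le_mul_of_nonneg_left ?_ (norm_nonneg _))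
        refine hC Ω _ ψ fun x => ?_
        rw [coe_inclTest hU, cutTest_apply, coe_inclTest hU]
    obtain ⟨f', hf', hnf'⟩ := exists_toDistr_eq_dual hs hF
    exact ⟨f', hf', hnf'.trans_le hn⟩

/-- Elements of `W^{s,p}(U)` vanishing off a set near which `χ = 1` extend to `W^{s,p}(Ω)`, with a
bound. -/
theorem exists_extend {n : ℕ} {U Ω : Opens (Space n)} (hU : U ≤ Ω) (s p : ℝ) [Fact (1 < p)]
    {K : Set (Space n)} {χ : 𝓓(U, ℝ)} (hχ : ∀ x ∈ K, χ =ᶠ[𝓝 x] 1) :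
    ∃ C : ℝ, ∀ f : Sobolev U s p, VanishesOff K f.toDistr →
      ∃ f' : Sobolev Ω s p, f'.toDistr = extDistr Ω χ f.toDistr ∧ ‖f'‖ ≤ C * ‖f‖ := by
  by_cases hs : 0 ≤ s
  · obtain ⟨C, hC⟩ := exists_extend_nonneg Ω hU s p hχ
    refine ⟨C, fun f hf => ?_⟩
    obtain ⟨w, hw, hn⟩ := exists_nonneg_toDistr_eq hs f
    obtain ⟨w', hw', hn'⟩ := hC w (hw ▸ hf)
    obtain ⟨f', hf', hnf'⟩ := exists_toDistr_eq_nonneg hs w'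
    refine ⟨f', by rw [hf', hw', hw], ?_⟩
    rw [hnf', ← hn]
    exact hn'
  -- Now the test functions live on `Ω` and their products with `χ` on `U`, so the multiplier is `χ`
  -- viewed on `Ω`.
  · obtain ⟨C, hC0, hC⟩ := exists_norm_testIncl_mul_le (-s) p.conjExponent (inclTest U Ω χ)
    refine ⟨C, fun f _ => ?_⟩
    obtain ⟨F, hF, hn⟩ := exists_dual_of_bound (s := s) (p := p) (extDistr Ω χ f.toDistr)
      (C := C * ‖f‖) (by positivity) fun ψ => by
        rw [extDistr_apply, mul_comm C, mul_assoc]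
        refine (abs_toDistr_le_of_neg hs f _).trans (mul_le_mul_of_nonneg_left ?_ (norm_nonneg _))
        refine hC U _ ψ fun x => ?_
        rw [cutTest_apply, coe_inclTest hU]
    obtain ⟨f', hf', hnf'⟩ := exists_toDistr_eq_dual hs hF
    exact ⟨f', hf', hnf'.trans_le hn⟩

/-- The extensions by zero of a compact set form a compact set. -/
theorem isCompact_extend {n : ℕ} {U Ω : Opens (Space n)} (hU : U ≤ Ω) {s p : ℝ} [Fact (1 < p)]
    {K : Set (Space n)} {χ : 𝓓(U, ℝ)} (hχ : ∀ x ∈ K, χ =ᶠ[𝓝 x] 1)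
    {S : Set (Sobolev U s p)} (hS : IsCompact S) :
    IsCompact {g : Sobolev Ω s p | ∃ f ∈ S, VanishesOff K f.toDistr ∧
      g.toDistr = extDistr Ω χ f.toDistr} := by
  obtain ⟨C, hC⟩ := exists_extend (Ω := Ω) hU s p hχ
  refine IsSeqCompact.isCompact fun g hg => ?_
  choose f hfS hfK hgf using hg
  obtain ⟨a, haS, j, hj, hja⟩ := hS.isSeqCompact hfS
  -- The extension exists only for elements vanishing off `K`; this condition is closed, so the
  -- limit `a` extends too.
  have haK : VanishesOff K a.toDistr := fun ψ hψ => by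
    refine tendsto_nhds_unique (((continuous_toDistr_apply ψ).tendsto a).comp hja) ?_
    exact tendsto_const_nhds.congr fun m => (hfK (j m) ψ hψ).symm
  obtain ⟨b, hb, -⟩ := hC a haK
  refine ⟨b, ⟨a, haS, haK, hb⟩, j, hj, ?_⟩
  rw [tendsto_iff_norm_sub_tendsto_zero] at hja ⊢
  refine squeeze_zero (fun _ => norm_nonneg _) (fun m => ?_)
    (by simpa using hja.const_mul C)
  -- The difference also vanishes off `K`, so the norm bound applies to its extension, which is `g
  -- (j m) - b`.
  have hdK : VanishesOff K (f (j m) - a).toDistr := fun ψ hψ => by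
    rw [map_sub]
    change (f (j m)).toDistr ψ - a.toDistr ψ = 0
    rw [hfK (j m) ψ hψ, haK ψ hψ, sub_zero]
  obtain ⟨d, hd, hdn⟩ := hC _ hdK
  have : g (j m) - b = d := toDistr_injective (by rw [map_sub, hd, hgf, hb, map_sub, map_sub])
  rw [Function.comp_apply, this]
  exact hdn

end Sobolev

/-! ### Compactness of the localized products -/

/-- Under the compact embedding for Lipschitz domains, the products `φ u` that are bounded in
`W^{s₁,p₁}(Ω)` lie in a compact subset of `W^{s₂,p₂}(Ω)`. -/
theorem exists_isCompact_mulDistr {n : ℕ} {Ω : Opens (Space n)}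
    (hLip : HasInteriorLipschitzProperty Ω) {s₁ s₂ p₁ p₂ : ℝ} [Fact (1 < p₁)] [Fact (1 < p₂)]
    (hcomp : ∀ U : Opens (Space n), IsLipschitzDomain U → IsCompactlyEmbedded s₁ p₁ s₂ p₂ U)
    (φ : 𝓓(Ω, ℝ)) (R : ℝ) :
    ∃ S : Set (Sobolev Ω s₂ p₂), IsCompact S ∧ ∀ (u : 𝓓'(Ω, ℝ)) (f : Sobolev Ω s₁ p₁),
      f.toDistr = mulDistr φ u → ‖f‖ ≤ R → ∃ v ∈ S, v.toDistr = mulDistr φ u := by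
  obtain ⟨U, hUL, hUΩ, hKU⟩ := hLip (tsupport φ) φ.hasCompactSupport φ.tsupport_subset
  obtain ⟨χ, hχ⟩ := exists_test_eq_one_near φ.hasCompactSupport hKU
  obtain ⟨T, hT, hTc⟩ := hcomp U hUL
  obtain ⟨C, hC⟩ := Sobolev.exists_restrict hUΩ s₁ p₁ χ
  obtain ⟨S, hS, hTS⟩ := IsCompactOperator.image_closedBall_subset_compact
    (f := (T : Sobolev U s₁ p₁ →ₗ[ℝ] Sobolev U s₂ p₂)) hTc (|C| * R)
  refine ⟨_, Sobolev.isCompact_extend hUΩ hχ hS, fun u f hf hfR => ?_⟩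
  -- Since `χ = 1` on `supp φ`, the product `φ u` does not notice the cut-off; hence restricting to
  -- `U` and extending back returns `φ u`.
  have hmul (ψ : 𝓓(Ω, ℝ)) : mulTest φ (inclTest U Ω (cutTest Ω χ ψ)) = mulTest φ ψ := by
    refine TestFunction.ext fun x => ?_
    rw [mulTest_apply, mulTest_apply, coe_inclTest hUΩ, cutTest_apply]
    by_cases hx : x ∈ tsupport φ
    · rw [(hχ x hx).eq_of_nhds, Pi.one_apply, mul_one]
    · rw [image_eq_zero_of_notMem_tsupport hx, mul_zero, mul_zero]
  have hcut (ψ : 𝓓(Ω, ℝ)) : f.toDistr ψ = f.toDistr (inclTest U Ω (cutTest Ω χ ψ)) := by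
    rw [hf, mulDistr_apply, mulDistr_apply, hmul]
  obtain ⟨f', hf', hn⟩ := hC f hcut
  have hvan : VanishesOff (tsupport φ) (T f').toDistr := fun ψ hψ => by
    rw [hT, hf', resDistr_apply, hf, mulDistr_apply]
    have h0 : mulTest φ (inclTest U Ω ψ) = 0 := by
      refine TestFunction.ext fun x => ?_
      rw [mulTest_apply, coe_inclTest hUΩ]
      by_cases hx : x ∈ tsupport φ
      · rw [(hψ x hx).eq_of_nhds, Pi.zero_apply, zero_mul]
        rfl
      · rw [image_eq_zero_of_notMem_tsupport hx, mul_zero]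
        rfl
    rw [h0, map_zero]
  obtain ⟨C', hC'⟩ := Sobolev.exists_extend (Ω := Ω) hUΩ s₂ p₂ hχ
  obtain ⟨v, hv, -⟩ := hC' (T f') hvan
  refine ⟨v, ⟨T f', hTS ⟨f', ?_, rfl⟩, hvan, hv⟩, ?_⟩
  · rw [mem_closedBall_zero_iff]
    refine hn.trans ((mul_le_mul_of_nonneg_right (le_abs_self C) (norm_nonneg f)).trans ?_)
    exact mul_le_mul_of_nonneg_left hfR (abs_nonneg C)
  · rw [hv, hT, hf']
    ext ψ
    rw [extDistr_apply, resDistr_apply, ← hcut, hf]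

/-! ### Convergence in locally Sobolev spaces -/

/-- Every open set admits a sequence of cut-off functions exhausting its compact subsets. -/
theorem exists_seq_test_eq_one_near {n : ℕ} (Ω : Opens (Space n)) :
    ∃ η : ℕ → 𝓓(Ω, ℝ), ∀ K : Set (Space n), IsCompact K → K ⊆ Ω →
      ∃ i, ∀ x ∈ K, η i x = 1 := by
  have : LocallyCompactSpace Ω := Ω.isOpen.locallyCompactSpace
  set E : CompactExhaustion Ω := CompactExhaustion.choice Ω
  have hE (i : ℕ) : ∃ χ : 𝓓(Ω, ℝ), ∀ x ∈ ((↑) '' E i : Set (Space n)), χ =ᶠ[𝓝 x] 1 :=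
    exists_test_eq_one_near ((E.isCompact i).image continuous_subtype_val) (by
      rintro _ ⟨x, -, rfl⟩
      exact x.2)
  choose η hη using hE
  refine ⟨η, fun K hK hKΩ => ?_⟩
  have hK' : IsCompact ((↑) ⁻¹' K : Set Ω) :=
    Topology.IsInducing.subtypeVal.isCompact_preimage' hK (by simpa using hKΩ)
  obtain ⟨i, hi⟩ := E.exists_superset_of_isCompact hK'
  exact ⟨i, fun x hx => (hη i x ⟨⟨x, hKΩ hx⟩, hi hx, rfl⟩).eq_of_nhds⟩

theorem mulTest_eq_self {n : ℕ} {Ω : Opens (Space n)} {η ψ : 𝓓(Ω, ℝ)}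
    (h : ∀ x ∈ tsupport ψ, η x = 1) : mulTest η ψ = ψ := by
  refine TestFunction.ext fun x => ?_
  rw [mulTest_apply]
  by_cases hx : x ∈ tsupport ψ
  · rw [h x hx, mul_one]
  · rw [image_eq_zero_of_notMem_tsupport hx, zero_mul]

/-- A sequence of distributions converges pointwise to a distribution if its products with cut-off
functions do. -/
theorem exists_tendsto_distr {n : ℕ} {Ω : Opens (Space n)} {η : ℕ → 𝓓(Ω, ℝ)}
    (hη : ∀ K : Set (Space n), IsCompact K → K ⊆ Ω → ∃ i, ∀ x ∈ K, η i x = 1)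
    {u : ℕ → 𝓓'(Ω, ℝ)} {a : ℕ → 𝓓'(Ω, ℝ)}
    (ha : ∀ i ψ, Tendsto (fun m => mulDistr (η i) (u m) ψ) atTop (𝓝 (a i ψ))) :
    ∃ W : 𝓓'(Ω, ℝ), ∀ ψ, Tendsto (fun m => u m ψ) atTop (𝓝 (W ψ)) := by
  have hlim {K : Set (Space n)} {i : ℕ} (hi : ∀ x ∈ K, η i x = 1) {ψ : 𝓓(Ω, ℝ)}
      (hψ : tsupport ψ ⊆ K) : Tendsto (fun m => u m ψ) atTop (𝓝 (a i ψ)) := by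
    refine (ha i ψ).congr fun m => ?_
    rw [mulDistr_apply, mulTest_eq_self fun x hx => hi x (hψ hx)]
  have hex (ψ : 𝓓(Ω, ℝ)) : ∃ L, Tendsto (fun m => u m ψ) atTop (𝓝 L) := by
    obtain ⟨i, hi⟩ := hη (tsupport ψ) ψ.hasCompactSupport ψ.tsupport_subset
    exact ⟨_, hlim hi le_rfl⟩
  choose L hL using hex
  refine ⟨TestFunction.mkCLM ℝ L (fun f g => ?_) (fun c f => ?_) (fun K hK => ?_), hL⟩
  · refine tendsto_nhds_unique (hL _) (((hL f).add (hL g)).congr fun m => ?_)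
    exact (map_add (u m) f g).symm
  · refine tendsto_nhds_unique (hL _) (((hL f).const_smul c).congr fun m => ?_)
    exact (map_smul (u m) c f).symm
  -- Continuity is checked on the test functions supported in each `K`. One index `i` serves all of
  -- them, and there the limit agrees with the distribution `a i`.
  · obtain ⟨i, hi⟩ := hη K K.isCompact hK
    refine ((a i).continuous.comp (TestFunction.continuous_ofSupportedIn hK)).congr fun f => ?_
    refine tendsto_nhds_unique (hlim hi ?_) (hL _)
    exact f.tsupport_subset

end LocallySobolev

/-! ### Extraction of the convergent subsequence -/

theorem mainTheorem5 {n : ℕ} (hn : 0 < n) (Ω : TopologicalSpace.Opens (Space n))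
    (hΩ : (Ω : Set (Space n)).Nonempty) (hLip : HasInteriorLipschitzProperty Ω)
    (s₁ s₂ p₁ p₂ : ℝ) [Fact (1 < p₁)] [Fact (1 < p₂)]
    (h₁ : IsSmoothMulTriple s₁ p₁ Ω) (h₁' : IsSmoothMulTriple (-s₁) p₁.conjExponent Ω)
    (h₂ : s₂ < 0 → IsSmoothMulTriple (-s₂) p₂.conjExponent Ω)
    (hcomp : ∀ U : TopologicalSpace.Opens (Space n),
      IsLipschitzDomain U → IsCompactlyEmbedded s₁ p₁ s₂ p₂ U)
    (u : ℕ → SobolevLoc Ω s₁ p₁) (hu : Bornology.IsVonNBounded ℝ (Set.range u)) :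
    ∃ j : ℕ → ℕ, StrictMono j ∧ ∃ v : ℕ → SobolevLoc Ω s₂ p₂,
      (∀ m, (v m).toDistr = (u (j m)).toDistr) ∧
      ∃ w : SobolevLoc Ω s₂ p₂, Filter.Tendsto v Filter.atTop (nhds w) := by
  have hb (φ : 𝓓(Ω, ℝ)) : ∃ S : Set (Sobolev Ω s₂ p₂), IsCompact S ∧
      ∀ m, ∃ v ∈ S, v.toDistr = mulDistr φ (u m).toDistr := by
    obtain ⟨R, -, hR⟩ :=
      (SobolevLoc.withSeminorms Ω s₁ p₁).isVonNBounded_iff_seminorm_bounded.1 hu φ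
    obtain ⟨S, hS, hSu⟩ := exists_isCompact_mulDistr hLip hcomp φ R
    exact ⟨S, hS, fun m => hSu _ (SobolevLoc.mulTo φ (u m)) rfl (hR _ (mem_range_self m)).le⟩
  choose S hS y hyS hy using hb
  obtain ⟨η, hη⟩ := exists_seq_test_eq_one_near Ω
  -- The diagonal argument: a countable product of compact sets in normed spaces is sequentially
  -- compact, so one `j` works for all `η i`.
  obtain ⟨a, -, j, hj, hja⟩ := (isCompact_univ_pi fun i => hS (η i)).tendsto_subseq
    (x := fun m i => y (η i) m) fun m i _ => hyS (η i) m
  rw [tendsto_pi_nhds] at hja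
  obtain ⟨W, hW⟩ := exists_tendsto_distr hη (u := fun m => (u (j m)).toDistr)
    (a := fun i => (a i).toDistr) fun i ψ => by
      refine (((Sobolev.continuous_toDistr_apply ψ).tendsto _).comp (hja i)).congr fun m => ?_
      exact congrArg (fun T : 𝓓'(Ω, ℝ) => T ψ) (hy (η i) (j m))
  -- Compactness gives a limit along a further subsequence, and convergence as distributions forces
  -- it to be `φ W`, whichever `k` was taken.
  have hsub (φ : 𝓓(Ω, ℝ)) (k : ℕ → ℕ) (hk : Tendsto k atTop atTop) :
      ∃ b : Sobolev Ω s₂ p₂, b.toDistr = mulDistr φ W ∧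
        ∃ l : ℕ → ℕ, Tendsto (fun m => y φ (j (k (l m)))) atTop (𝓝 b) := by
    obtain ⟨b, -, l, hl, hlb⟩ := (hS φ).tendsto_subseq (x := fun m => y φ (j (k m)))
      fun m => hyS φ _
    refine ⟨b, ?_, l, hlb⟩
    ext ψ
    refine tendsto_nhds_unique (((Sobolev.continuous_toDistr_apply ψ).tendsto b).comp hlb) ?_
    refine (((hW (mulTest φ ψ)).comp hk).comp hl.tendsto_atTop).congr fun m => ?_
    exact (congrArg (fun T : 𝓓'(Ω, ℝ) => T ψ) (hy φ (j (k (l m))))).symm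
  have hlim (φ : 𝓓(Ω, ℝ)) : ∃ b : Sobolev Ω s₂ p₂, b.toDistr = mulDistr φ W ∧
      Tendsto (fun m => y φ (j m)) atTop (𝓝 b) := by
    obtain ⟨b, hb, -⟩ := hsub φ id tendsto_id
    -- Every subsequence has a further one with the same limit `b`, so no new extraction is needed
    -- for the uncountably many `φ`.
    refine ⟨b, hb, tendsto_of_subseq_tendsto fun k hk => ?_⟩
    obtain ⟨b', hb', l, hl⟩ := hsub φ k hk
    obtain rfl : b' = b := Sobolev.toDistr_injective (hb'.trans hb.symm)
    exact ⟨l, hl⟩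
  choose b hb hbt using hlim
  have hmem {T : 𝓓'(Ω, ℝ)} {z : 𝓓(Ω, ℝ) → Sobolev Ω s₂ p₂}
      (hz : ∀ φ, (z φ).toDistr = mulDistr φ T) : T ∈ sobolevLocSubmodule Ω s₂ p₂ :=
    (Submodule.mem_iInf _).2 fun φ => Submodule.mem_comap.2 (by
      change mulDistr φ T ∈ sobolevSubmodule Ω s₂ p₂
      rw [← hz φ]
      exact (z φ).2)
  set v : ℕ → SobolevLoc Ω s₂ p₂ := fun m =>
    (⟨(u (j m)).toDistr, hmem fun φ => hy φ (j m)⟩ : sobolevLocSubmodule Ω s₂ p₂) with hv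
  set w : SobolevLoc Ω s₂ p₂ := (⟨W, hmem hb⟩ : sobolevLocSubmodule Ω s₂ p₂) with hw
  refine ⟨j, hj, v, fun m => rfl, w, ?_⟩
  rw [(SobolevLoc.withSeminorms Ω s₂ p₂).tendsto_nhds]
  intro φ ε hε
  have h1 (m : ℕ) : SobolevLoc.mulTo φ (v m) = y φ (j m) :=
    Sobolev.toDistr_injective (hy φ (j m)).symm
  have h2 : SobolevLoc.mulTo φ w = b φ := Sobolev.toDistr_injective (hb φ).symm
  filter_upwards [(tendsto_iff_norm_sub_tendsto_zero.1 (hbt φ)).eventually_lt_const hε] with m hm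
  change ‖SobolevLoc.mulTo φ (v m - w)‖ < ε
  rwa [map_sub, h1, h2]
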